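/- Let $\mathbf k$ be a field of characteristic zero and let $\mathbf C_*(\mathbf k)$ be the category of ($\mathbb Z$-graded) chain complexes of $\mathbf k$-vector spaces with differential of degree $-1$. All pairs $(g,l)$ below are stable: $g,l\ge 0$ and $2g-2+l>0$; the modular dimension of $(g,l)$ is $d(g,l)=3g-3+l\ge 0$. A dg modular $\Sigma$-module is a family $E((g,l))$ of chain complexes with right $\Sigma_l$-actions. A dg modular operad is a dg modular $\Sigma$-module $P$ with composition maps $\circ_i:P((g,l))\otimes P((h,m))\to P((g+h,l+m-2))$ and contractions $\xi_{ij}:P((g,l))\to P((g+1,l-2))$, satisfying the axioms of equivariance, associativity, commutativity and compatibility of Getzler and Kapranov. A weak equivalence of dg modular operads is a morphism which is a quasi-isomorphism for each $(g,l)$. Let $t_n$ be the functor that truncates a dg modular operad to the pairs with $d(g,l)\le n$, with values in $n$-truncated dg modular operads, and let $t_!$ be its left adjoint. If $V$ is a dg modular $\Sigma$-module concentrated in modular dimension $n$, with zero differential, and $\xi:V[-1]\to P_n$ is a morphism of dg modular $\Sigma$-modules (where $P_n$ is the part of $P$ of modular dimension $n$), the principal extension $P\to P\sqcup_\xi V$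 is defined by the universal property that the morphisms $P\sqcup_\xi V\to Q$ are the pairs $(f,g)$, where $f:P\to Q$ is a morphism of dg modular operads and $g:V\to Q$ is a homogeneous map of degree $0$ of graded modular $\Sigma$-modules with $d_Qg-gd_V=f\xi$. A dg modular operad $M$ is minimal if, for every $n\ge 0$, the canonical morphism $t_!t_{n-1}M\to t_!t_nM$ (with $t_!t_{-1}M=0$) is a principal extension $t_!t_{n-1}M\to t_!t_{n-1}M\sqcup_{\xi_n} V_n$ by some $V_n$ concentrated in modular dimension $n$ with zero differential; for $n=0$ this says that $t_!t_0M$ is the free modular operad generated by $V_0$. **Theorem.** For every dg modular operad $P$ in $\mathbf C_*(\mathbf k)$ there are a minimal dg modular operad $P_\infty$ and a weak equivalence $P_\infty\to P$; that is, $P$ has a minimal model. Moreover $P_\infty$ is the direct limit of its canonical tower of principal extensions $$0\to t_!t_0P_\infty\to t_!t_1P_\infty\to\cdots\to t_!t_{n}P_\infty\to\cdots .$$ -/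

import Mathlib

open CategoryTheory

universe u

/-! ### Stable pairs and their modular dimension -/

/-- The pairs `(g, l)` with `g, l ≥ 0`, `2g - 2 + l > 0` and modular dimension
`3g - 3 + l ≤ n`.  For `n = ⊤` these are all stable pairs. -/
@[ext]
structure StablePair (n : WithTop ℤ) where
  g : ℕ
  l : ℕ
  stable : 0 < 2 * (g : ℤ) - 2 + l
  le : ((3 * (g : ℤ) - 3 + l : ℤ) : WithTop ℤ) ≤ n

namespace StablePair

/-- The modular dimension `d(g, l) = 3g - 3 + l`. -/
def dim {n : WithTop ℤ} (a : StablePair n) : ℤ := 3 * (a.g : ℤ) - 3 + a.l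

/-- The legs `1, …, l`. -/
abbrev Leg {n : WithTop ℤ} (a : StablePair n) : Type := Fin a.l

def incl {m n : WithTop ℤ} (h : m ≤ n) (a : StablePair m) : StablePair n :=
  ⟨a.g, a.l, a.stable, a.le.trans h⟩

end StablePair

/-! ### Labellings of legs

Gluing two legs produces an edge with two ends `false`, `true`.  A bijection
`e : A ≃ D ⊕ Bool` picks two legs out of `A` (those with values `Sum.inr false`, `Sum.inr true`),
which become the ends of the edge, and names the remaining ones by `D`. -/

/-- The bijection `e` glues a leg in `A` (end `false`) to a leg in `B` (end `true`). -/
def Joins {A B D : Type} (e : A ⊕ B ≃ D ⊕ Bool) : Prop :=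
  (∃ i, e (Sum.inl i) = Sum.inr false) ∧ ∃ j, e (Sum.inr j) = Sum.inr true

/-- The labelling of a leg after two successive gluings, when the leg is present in both of them.
The final labels are the remaining legs `F`, the ends of the first edge and
the ends of the second edge. -/
def bothGluings {D F : Type} (f : D → F ⊕ Bool) : D ⊕ Bool → F ⊕ (Bool ⊕ Bool)
  | Sum.inl d => Sum.map id Sum.inr (f d)
  | Sum.inr b => Sum.inr (Sum.inl b)

/-- The labelling of a leg that takes part in the second gluing only. -/
def secondGluing {F : Type} : F ⊕ Bool → F ⊕ (Bool ⊕ Bool) := Sum.map id Sum.inr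

/-- Exchange the roles of the first and the second edge. -/
def swapEdges {F : Type} : F ⊕ (Bool ⊕ Bool) → F ⊕ (Bool ⊕ Bool) := Sum.map id Sum.swap

/-- Exchange the two ends of an edge. -/
def flipEdge (F : Type) : F ⊕ Bool ≃ F ⊕ Bool := Equiv.sumCongr (Equiv.refl F) Equiv.boolNot

/-- The Koszul sign `(-1)^p` in the field `k`. -/
def koszul (k : Type u) [Field k] (p : ℤ) : k := ((p.negOnePow : ℤ) : k)

/-! ### dg modular `Σ`-modules and dg modular operads -/

/-- A dg modular `Σ`-module (in modular dimensions `≤ n`): chain complexes with a differential of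
degree `-1` and a right action of `Σ_l`. -/
structure ModularModule (k : Type u) [Field k] (n : WithTop ℤ) where
  X : StablePair n → ChainComplex (ModuleCat.{u} k) ℤ
  act : ∀ a : StablePair n, Equiv.Perm a.Leg → (X a ⟶ X a)
  act_one : ∀ a, act a 1 = 𝟙 (X a)
  act_mul : ∀ a (σ τ : Equiv.Perm a.Leg), act a (σ * τ) = act a σ ≫ act a τ

/-- A dg modular operad defined in modular dimensions `≤ n`; for `n = ⊤` this is a dg modular
operad, for `n : ℤ` it is an `n`-truncated dg modular operad.

`x · σ` is `x` with the leg `i` renamed `σ⁻¹ i`.  The compositions are recorded for every choice of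
a leg `i` of `x`, a leg `j` of `y` and a numbering of the remaining legs, all of this
being encoded by a bijection `e` with `Joins e`; likewise for the contractions `ξ_ij`.  By the
equivariance axioms all the compositions `P((g,l)) ⊗ P((h,m)) ⟶ P((g+h,l+m-2))` are determined by
the ones with a fixed `j` and a standard numbering, which are the usual `∘_i`. -/
structure ModularOperad (k : Type u) [Field k] (n : WithTop ℤ) extends ModularModule k n where
  comp : ∀ {a b c : StablePair n}, c.g = a.g + b.g →
    ∀ e : a.Leg ⊕ b.Leg ≃ c.Leg ⊕ Bool, Joins e → ∀ {p q r : ℤ}, p + q = r →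
      ((X a).X p →ₗ[k] (X b).X q →ₗ[k] (X c).X r)
  contr : ∀ {a c : StablePair n}, c.g = a.g + 1 → (a.Leg ≃ c.Leg ⊕ Bool) → (X a ⟶ X c)
  /-- the compositions are chain maps on the tensor product -/
  comp_d : ∀ {a b c : StablePair n} (hg : c.g = a.g + b.g) (e : a.Leg ⊕ b.Leg ≃ c.Leg ⊕ Bool)
    (he : Joins e) {p q r p' q' r' : ℤ} (h : p + q = r) (h₁ : p' + q = r') (h₂ : p + q' = r')
    (_ : r' + 1 = r) (x : (X a).X p) (y : (X b).X q),
    (X c).d r r' (comp hg e he h x y) =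
      comp hg e he h₁ ((X a).d p p' x) y + koszul k p • comp hg e he h₂ x ((X b).d q q' y)
  /-- equivariance of the compositions -/
  comp_act_in : ∀ {a b c : StablePair n} (hg : c.g = a.g + b.g)
    (e : a.Leg ⊕ b.Leg ≃ c.Leg ⊕ Bool) (he : Joins e)
    (σ : Equiv.Perm a.Leg) (τ : Equiv.Perm b.Leg)
    (he' : Joins ((Equiv.sumCongr σ.symm τ.symm).trans e))
    {p q r : ℤ} (h : p + q = r) (x : (X a).X p) (y : (X b).X q),
    comp hg e he h ((act a σ).f p x) ((act b τ).f q y) = comp hg _ he' h x y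
  comp_act_out : ∀ {a b c : StablePair n} (hg : c.g = a.g + b.g)
    (e : a.Leg ⊕ b.Leg ≃ c.Leg ⊕ Bool) (he : Joins e) (σ : Equiv.Perm c.Leg)
    (he' : Joins (e.trans (Equiv.sumCongr σ.symm (Equiv.refl Bool))))
    {p q r : ℤ} (h : p + q = r) (x : (X a).X p) (y : (X b).X q),
    (act c σ).f r (comp hg e he h x y) = comp hg _ he' h x y
  /-- equivariance of the contractions -/
  contr_act_in : ∀ {a c : StablePair n} (hg : c.g = a.g + 1) (e : a.Leg ≃ c.Leg ⊕ Bool)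
    (σ : Equiv.Perm a.Leg), act a σ ≫ contr hg e = contr hg (σ.symm.trans e)
  contr_act_out : ∀ {a c : StablePair n} (hg : c.g = a.g + 1) (e : a.Leg ≃ c.Leg ⊕ Bool)
    (σ : Equiv.Perm c.Leg),
    contr hg e ≫ act c σ = contr hg (e.trans (Equiv.sumCongr σ.symm (Equiv.refl Bool)))
  /-- commutativity of the compositions -/
  comp_comm : ∀ {a b c : StablePair n} (hg : c.g = a.g + b.g) (hg' : c.g = b.g + a.g)
    (e : a.Leg ⊕ b.Leg ≃ c.Leg ⊕ Bool) (he : Joins e)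
    (he' : Joins (((Equiv.sumComm b.Leg a.Leg).trans e).trans (flipEdge c.Leg)))
    {p q r : ℤ} (h : p + q = r) (h' : q + p = r) (x : (X a).X p) (y : (X b).X q),
    comp hg e he h x y = koszul k (p * q) • comp hg' _ he' h' y x
  /-- `ξ_ij = ξ_ji` -/
  contr_comm : ∀ {a c : StablePair n} (hg : c.g = a.g + 1) (e : a.Leg ≃ c.Leg ⊕ Bool),
    contr hg (e.trans (flipEdge c.Leg)) = contr hg e
  /-- `(x ∘ y) ∘ z = x ∘ (y ∘ z)`, where `y` is glued both to `x` and to `z` -/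
  comp_assoc : ∀ {a b c ab bc t : StablePair n}
    (hab : ab.g = a.g + b.g) (ht : t.g = ab.g + c.g)
    (hbc : bc.g = b.g + c.g) (ht' : t.g = a.g + bc.g)
    (e : a.Leg ⊕ b.Leg ≃ ab.Leg ⊕ Bool) (f : ab.Leg ⊕ c.Leg ≃ t.Leg ⊕ Bool)
    (e' : b.Leg ⊕ c.Leg ≃ bc.Leg ⊕ Bool) (f' : a.Leg ⊕ bc.Leg ≃ t.Leg ⊕ Bool)
    (he : Joins e) (hf : Joins f) (he' : Joins e') (hf' : Joins f')
    (_ : ∀ i, bothGluings (f ∘ Sum.inl) (e (Sum.inl i)) =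
      swapEdges (secondGluing (f' (Sum.inl i))))
    (_ : ∀ i, bothGluings (f ∘ Sum.inl) (e (Sum.inr i)) =
      swapEdges (bothGluings (f' ∘ Sum.inr) (e' (Sum.inl i))))
    (_ : ∀ i, secondGluing (f (Sum.inr i)) =
      swapEdges (bothGluings (f' ∘ Sum.inr) (e' (Sum.inr i))))
    {p q r pq qr s : ℤ} (h₁ : p + q = pq) (h₂ : pq + r = s) (h₃ : q + r = qr) (h₄ : p + qr = s)
    (x : (X a).X p) (y : (X b).X q) (z : (X c).X r),
    comp ht f hf h₂ (comp hab e he h₁ x y) z = comp ht' f' hf' h₄ x (comp hbc e' he' h₃ y z)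
  /-- two contractions commute -/
  contr_contr : ∀ {a b b' c : StablePair n} (h₁ : b.g = a.g + 1) (h₂ : c.g = b.g + 1)
    (h₃ : b'.g = a.g + 1) (h₄ : c.g = b'.g + 1)
    (e : a.Leg ≃ b.Leg ⊕ Bool) (f : b.Leg ≃ c.Leg ⊕ Bool)
    (e' : a.Leg ≃ b'.Leg ⊕ Bool) (f' : b'.Leg ≃ c.Leg ⊕ Bool)
    (_ : ∀ i, bothGluings f (e i) = swapEdges (bothGluings f' (e' i))),
    contr h₁ e ≫ contr h₂ f = contr h₃ e' ≫ contr h₄ f'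
  /-- `ξ_ij (x ∘ y) = (ξ_ij x) ∘ y`, where `i`, `j` are legs of `x` -/
  contr_comp_left : ∀ {a b ab a' t : StablePair n} (h₁ : ab.g = a.g + b.g) (h₂ : t.g = ab.g + 1)
    (h₃ : a'.g = a.g + 1) (h₄ : t.g = a'.g + b.g)
    (e : a.Leg ⊕ b.Leg ≃ ab.Leg ⊕ Bool) (f : ab.Leg ≃ t.Leg ⊕ Bool)
    (e' : a.Leg ≃ a'.Leg ⊕ Bool) (f' : a'.Leg ⊕ b.Leg ≃ t.Leg ⊕ Bool)
    (he : Joins e) (hf' : Joins f')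
    (_ : ∀ i, bothGluings f (e (Sum.inl i)) = swapEdges (bothGluings (f' ∘ Sum.inl) (e' i)))
    (_ : ∀ i, bothGluings f (e (Sum.inr i)) = swapEdges (secondGluing (f' (Sum.inr i))))
    {p q r : ℤ} (h : p + q = r) (x : (X a).X p) (y : (X b).X q),
    (contr h₂ f).f r (comp h₁ e he h x y) = comp h₄ f' hf' h ((contr h₃ e').f p x) y
  /-- `ξ_ij (x ∘ y) = ξ_i'j' (x ∘' y)`, where `∘` glues the leg `i'` of `x` to the leg `j'` of `y`
  and `∘'` glues the leg `i` of `x` to the leg `j` of `y` -/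
  contr_comp : ∀ {a b ab ab' t : StablePair n} (h₁ : ab.g = a.g + b.g) (h₂ : t.g = ab.g + 1)
    (h₃ : ab'.g = a.g + b.g) (h₄ : t.g = ab'.g + 1)
    (e : a.Leg ⊕ b.Leg ≃ ab.Leg ⊕ Bool) (f : ab.Leg ≃ t.Leg ⊕ Bool)
    (e' : a.Leg ⊕ b.Leg ≃ ab'.Leg ⊕ Bool) (f' : ab'.Leg ≃ t.Leg ⊕ Bool)
    (he : Joins e) (he' : Joins e')
    (_ : ∀ i, bothGluings f (e i) = swapEdges (bothGluings f' (e' i)))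
    {p q r : ℤ} (h : p + q = r) (x : (X a).X p) (y : (X b).X q),
    (contr h₂ f).f r (comp h₁ e he h x y) = (contr h₄ f').f r (comp h₃ e' he' h x y)

namespace ModularOperad

variable {k : Type u} [Field k] {m n : WithTop ℤ}

/-- Morphisms of (truncated) dg modular operads. -/
@[ext]
structure Hom (P Q : ModularOperad k n) where
  app : ∀ a, P.X a ⟶ Q.X a
  act : ∀ a σ, P.act a σ ≫ app a = app a ≫ Q.act a σ
  contr : ∀ {a c : StablePair n} (hg : c.g = a.g + 1) (e : a.Leg ≃ c.Leg ⊕ Bool),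
    P.contr hg e ≫ app c = app a ≫ Q.contr hg e
  comp : ∀ {a b c : StablePair n} (hg : c.g = a.g + b.g) (e : a.Leg ⊕ b.Leg ≃ c.Leg ⊕ Bool)
    (he : Joins e) {p q r : ℤ} (h : p + q = r) (x : (P.X a).X p) (y : (P.X b).X q),
    (app c).f r (P.comp hg e he h x y) = Q.comp hg e he h ((app a).f p x) ((app b).f q y)

instance : Category (ModularOperad k n) where
  Hom := Hom
  id P := { app := fun a => 𝟙 _, act := by simp, contr := by simp, comp := by simp }
  comp f g :=
    { app := fun a => f.app a ≫ g.app a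
      act := fun a σ => by rw [← Category.assoc, f.act, Category.assoc, g.act, Category.assoc]
      contr := fun hg e => by
        rw [← Category.assoc, f.contr, Category.assoc, g.contr, Category.assoc]
      comp := fun hg e he p q r h x y => by simp [f.comp, g.comp] }

@[ext]
theorem hom_ext {P Q : ModularOperad k n} {f g : P ⟶ Q} (h : ∀ a, f.app a = g.app a) : f = g :=
  Hom.ext (funext h)

/-- A weak equivalence is a morphism which is a quasi-isomorphism in every `(g, l)`. -/
def IsWeakEquivalence {P Q : ModularOperad k n} (f : P ⟶ Q) : Prop :=
  ∀ a, QuasiIso (f.app a)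

/-! ### Truncation -/

/-- The underlying object of the truncation. -/
def truncObj {m n : WithTop ℤ} (hmn : m ≤ n) (P : ModularOperad k n) : ModularOperad k m where
  X := fun a => P.X (a.incl hmn)
  act := fun a σ => P.act (a.incl hmn) σ
  act_one := fun a => P.act_one (a.incl hmn)
  act_mul := fun a σ τ => P.act_mul (a.incl hmn) σ τ
  comp := fun {a b c} hg e he _ _ _ h =>
    P.comp (a := a.incl hmn) (b := b.incl hmn) (c := c.incl hmn) hg e he h
  contr := fun {a c} hg e => P.contr (a := a.incl hmn) (c := c.incl hmn) hg e
  comp_d := fun {a b c} hg e he =>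
    P.comp_d (a := a.incl hmn) (b := b.incl hmn) (c := c.incl hmn) hg e he
  comp_act_in := fun {a b c} hg e he =>
    P.comp_act_in (a := a.incl hmn) (b := b.incl hmn) (c := c.incl hmn) hg e he
  comp_act_out := fun {a b c} hg e he =>
    P.comp_act_out (a := a.incl hmn) (b := b.incl hmn) (c := c.incl hmn) hg e he
  contr_act_in := fun {a c} hg e =>
    P.contr_act_in (a := a.incl hmn) (c := c.incl hmn) hg e
  contr_act_out := fun {a c} hg e =>
    P.contr_act_out (a := a.incl hmn) (c := c.incl hmn) hg e
  comp_comm := fun {a b c} hg hg' e he =>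
    P.comp_comm (a := a.incl hmn) (b := b.incl hmn) (c := c.incl hmn) hg hg' e he
  contr_comm := fun {a c} hg e =>
    P.contr_comm (a := a.incl hmn) (c := c.incl hmn) hg e
  comp_assoc := fun {a b c ab bc t} h₁ h₂ h₃ h₄ =>
    P.comp_assoc (a := a.incl hmn) (b := b.incl hmn) (c := c.incl hmn)
      (ab := ab.incl hmn) (bc := bc.incl hmn) (t := t.incl hmn) h₁ h₂ h₃ h₄
  contr_contr := fun {a b b' c} h₁ h₂ h₃ h₄ =>
    P.contr_contr (a := a.incl hmn) (b := b.incl hmn)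
      (b' := b'.incl hmn) (c := c.incl hmn) h₁ h₂ h₃ h₄
  contr_comp_left := fun {a b ab a' t} h₁ h₂ h₃ h₄ =>
    P.contr_comp_left (a := a.incl hmn) (b := b.incl hmn)
      (ab := ab.incl hmn) (a' := a'.incl hmn) (t := t.incl hmn) h₁ h₂ h₃ h₄
  contr_comp := fun {a b ab ab' t} h₁ h₂ h₃ h₄ =>
    P.contr_comp (a := a.incl hmn) (b := b.incl hmn)
      (ab := ab.incl hmn) (ab' := ab'.incl hmn) (t := t.incl hmn) h₁ h₂ h₃ h₄

/-- The truncation functor `t_m`, which forgets the modular dimensions `> m`. -/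
def trunc (k : Type u) [Field k] {m n : WithTop ℤ} (hmn : m ≤ n) :
    ModularOperad k n ⥤ ModularOperad k m where
  obj P := truncObj hmn P
  map f :=
    { app := fun a => f.app (a.incl hmn)
      act := fun a σ => f.act (a.incl hmn) σ
      contr := fun {a c} hg e => f.contr (a := a.incl hmn) (c := c.incl hmn) hg e
      comp := fun {a b c} hg e he p q r h x y =>
        f.comp (a := a.incl hmn) (b := b.incl hmn) (c := c.incl hmn) hg e he h x y }

/-! ### The left adjoint `t_!` of the truncation functor

`t_! P` adds freely to `P` the operations in modular dimensions `> m`.  It is built from formal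
expressions in the elements of `P`, modulo the congruence generated by the axioms of a dg modular
operad and the relations which hold in `P`. -/

section LeftAdjoint

/-- Formal expressions. -/
inductive Expr (hmn : m ≤ n) (P : ModularOperad k m) : StablePair n → ℤ → Type u
  | of (a : StablePair m) (p : ℤ) (x : (P.X a).X p) : Expr hmn P (a.incl hmn) p
  | zero {a : StablePair n} {p : ℤ} : Expr hmn P a p
  | add {a : StablePair n} {p : ℤ} (x y : Expr hmn P a p) : Expr hmn P a p
  | smul {a : StablePair n} {p : ℤ} (s : k) (x : Expr hmn P a p) : Expr hmn P a p
  | d {a : StablePair n} {p : ℤ} (p' : ℤ) (x : Expr hmn P a p) : Expr hmn P a p'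
  | act {a : StablePair n} {p : ℤ} (σ : Equiv.Perm a.Leg) (x : Expr hmn P a p) : Expr hmn P a p
  | contr {a c : StablePair n} {p : ℤ} (hg : c.g = a.g + 1) (e : a.Leg ≃ c.Leg ⊕ Bool)
      (x : Expr hmn P a p) : Expr hmn P c p
  | comp {a b c : StablePair n} {p q r : ℤ} (hg : c.g = a.g + b.g)
      (e : a.Leg ⊕ b.Leg ≃ c.Leg ⊕ Bool) (he : Joins e) (h : p + q = r)
      (x : Expr hmn P a p) (y : Expr hmn P b q) : Expr hmn P c r

open _root_.ModularOperad.Expr in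
/-- The congruence generated by the axioms and by the relations of `P`. -/
inductive Expr.Rel (hmn : m ≤ n) (P : ModularOperad k m) :
    ∀ {a : StablePair n} {p : ℤ}, Expr hmn P a p → Expr hmn P a p → Prop
  -- equivalence relation
  | refl {a : StablePair n} {p : ℤ} (x : Expr hmn P a p) : Rel hmn P x x
  | symm {a : StablePair n} {p : ℤ} {x y : Expr hmn P a p} : Rel hmn P x y → Rel hmn P y x
  | trans {a : StablePair n} {p : ℤ} {x y z : Expr hmn P a p} : Rel hmn P x y → Rel hmn P y z → Rel hmn P x z
  -- compatibility with the operations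
  | add_congr {a : StablePair n} {p : ℤ} {x x' y y' : Expr hmn P a p} :
      Rel hmn P x x' → Rel hmn P y y' → Rel hmn P (add x y) (add x' y')
  | smul_congr {a : StablePair n} {p : ℤ} (s : k) {x x' : Expr hmn P a p} :
      Rel hmn P x x' → Rel hmn P (smul s x) (smul s x')
  | d_congr {a : StablePair n} {p : ℤ} (p' : ℤ) {x x' : Expr hmn P a p} : Rel hmn P x x' → Rel hmn P (d p' x) (d p' x')
  | act_congr {a : StablePair n} {p : ℤ} (σ : Equiv.Perm a.Leg) {x x' : Expr hmn P a p} :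
      Rel hmn P x x' → Rel hmn P (act σ x) (act σ x')
  | contr_congr {a c : StablePair n} {p : ℤ} (hg : c.g = a.g + 1) (e : a.Leg ≃ c.Leg ⊕ Bool) {x x' : Expr hmn P a p} :
      Rel hmn P x x' → Rel hmn P (contr hg e x) (contr hg e x')
  | comp_congr {a b c : StablePair n} {p q r : ℤ} (hg : c.g = a.g + b.g)
      (e : a.Leg ⊕ b.Leg ≃ c.Leg ⊕ Bool) (he : Joins e) (h : p + q = r)
      {x x' : Expr hmn P a p} {y y' : Expr hmn P b q} : Rel hmn P x x' → Rel hmn P y y' →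
      Rel hmn P (comp hg e he h x y) (comp hg e he h x' y')
  -- vector spaces
  | add_assoc {a : StablePair n} {p : ℤ} (x y z : Expr hmn P a p) : Rel hmn P (add (add x y) z) (add x (add y z))
  | add_comm {a : StablePair n} {p : ℤ} (x y : Expr hmn P a p) : Rel hmn P (add x y) (add y x)
  | zero_add {a : StablePair n} {p : ℤ} (x : Expr hmn P a p) : Rel hmn P (add zero x) x
  | smul_add {a : StablePair n} {p : ℤ} (s : k) (x y : Expr hmn P a p) :
      Rel hmn P (smul s (add x y)) (add (smul s x) (smul s y))
  | add_smul {a : StablePair n} {p : ℤ} (s t : k) (x : Expr hmn P a p) :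
      Rel hmn P (smul (s + t) x) (add (smul s x) (smul t x))
  | mul_smul {a : StablePair n} {p : ℤ} (s t : k) (x : Expr hmn P a p) :
      Rel hmn P (smul (s * t) x) (smul s (smul t x))
  | one_smul {a : StablePair n} {p : ℤ} (x : Expr hmn P a p) : Rel hmn P (smul 1 x) x
  | zero_smul {a : StablePair n} {p : ℤ} (x : Expr hmn P a p) : Rel hmn P (smul 0 x) zero
  -- linearity
  | d_add {a : StablePair n} {p : ℤ} (p' : ℤ) (x y : Expr hmn P a p) :
      Rel hmn P (d p' (add x y)) (add (d p' x) (d p' y))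
  | d_smul {a : StablePair n} {p : ℤ} (p' : ℤ) (s : k) (x : Expr hmn P a p) :
      Rel hmn P (d p' (smul s x)) (smul s (d p' x))
  | act_add {a : StablePair n} {p : ℤ} (σ : Equiv.Perm a.Leg) (x y : Expr hmn P a p) :
      Rel hmn P (act σ (add x y)) (add (act σ x) (act σ y))
  | act_smul {a : StablePair n} {p : ℤ} (σ : Equiv.Perm a.Leg) (s : k) (x : Expr hmn P a p) :
      Rel hmn P (act σ (smul s x)) (smul s (act σ x))
  | contr_add {a c : StablePair n} {p : ℤ} (hg : c.g = a.g + 1) (e : a.Leg ≃ c.Leg ⊕ Bool) (x y : Expr hmn P a p) :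
      Rel hmn P (contr hg e (add x y)) (add (contr hg e x) (contr hg e y))
  | contr_smul {a c : StablePair n} {p : ℤ} (hg : c.g = a.g + 1) (e : a.Leg ≃ c.Leg ⊕ Bool) (s : k)
      (x : Expr hmn P a p) : Rel hmn P (contr hg e (smul s x)) (smul s (contr hg e x))
  | comp_add_left {a b c : StablePair n} {p q r : ℤ} (hg : c.g = a.g + b.g)
      (e : a.Leg ⊕ b.Leg ≃ c.Leg ⊕ Bool) (he : Joins e) (h : p + q = r)
      (x x' : Expr hmn P a p) (y : Expr hmn P b q) :
      Rel hmn P (comp hg e he h (add x x') y) (add (comp hg e he h x y) (comp hg e he h x' y))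
  | comp_smul_left {a b c : StablePair n} {p q r : ℤ} (hg : c.g = a.g + b.g)
      (e : a.Leg ⊕ b.Leg ≃ c.Leg ⊕ Bool) (he : Joins e) (h : p + q = r)
      (s : k) (x : Expr hmn P a p) (y : Expr hmn P b q) :
      Rel hmn P (comp hg e he h (smul s x) y) (smul s (comp hg e he h x y))
  | comp_add_right {a b c : StablePair n} {p q r : ℤ} (hg : c.g = a.g + b.g)
      (e : a.Leg ⊕ b.Leg ≃ c.Leg ⊕ Bool) (he : Joins e) (h : p + q = r)
      (x : Expr hmn P a p) (y y' : Expr hmn P b q) :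
      Rel hmn P (comp hg e he h x (add y y')) (add (comp hg e he h x y) (comp hg e he h x y'))
  | comp_smul_right {a b c : StablePair n} {p q r : ℤ} (hg : c.g = a.g + b.g)
      (e : a.Leg ⊕ b.Leg ≃ c.Leg ⊕ Bool) (he : Joins e) (h : p + q = r)
      (s : k) (x : Expr hmn P a p) (y : Expr hmn P b q) :
      Rel hmn P (comp hg e he h x (smul s y)) (smul s (comp hg e he h x y))
  -- complexes and chain maps
  | d_shape {a : StablePair n} {p : ℤ} (p' : ℤ) (_ : p' + 1 ≠ p) (x : Expr hmn P a p) : Rel hmn P (d p' x) zero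
  | d_d {a : StablePair n} {p : ℤ} (p' p'' : ℤ) (x : Expr hmn P a p) : Rel hmn P (d p'' (d p' x)) zero
  | act_d {a : StablePair n} {p : ℤ} (σ : Equiv.Perm a.Leg) (p' : ℤ) (x : Expr hmn P a p) :
      Rel hmn P (d p' (act σ x)) (act σ (d p' x))
  | contr_d {a c : StablePair n} {p : ℤ} (hg : c.g = a.g + 1) (e : a.Leg ≃ c.Leg ⊕ Bool) (p' : ℤ)
      (x : Expr hmn P a p) : Rel hmn P (d p' (contr hg e x)) (contr hg e (d p' x))
  | comp_d {a b c : StablePair n} (hg : c.g = a.g + b.g) (e : a.Leg ⊕ b.Leg ≃ c.Leg ⊕ Bool)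
      (he : Joins e) {p q r p' q' r' : ℤ} (h : p + q = r) (h₁ : p' + q = r') (h₂ : p + q' = r')
      (_ : r' + 1 = r) (x : Expr hmn P a p) (y : Expr hmn P b q) :
      Rel hmn P (d r' (comp hg e he h x y))
        (add (comp hg e he h₁ (d p' x) y) (smul (koszul k p) (comp hg e he h₂ x (d q' y))))
  -- modular operads
  | act_one {a : StablePair n} {p : ℤ} (x : Expr hmn P a p) : Rel hmn P (act 1 x) x
  | act_mul {a : StablePair n} {p : ℤ} (σ τ : Equiv.Perm a.Leg) (x : Expr hmn P a p) :
      Rel hmn P (act (σ * τ) x) (act τ (act σ x))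
  | comp_act_in {a b c : StablePair n} (hg : c.g = a.g + b.g)
      (e : a.Leg ⊕ b.Leg ≃ c.Leg ⊕ Bool) (he : Joins e)
      (σ : Equiv.Perm a.Leg) (τ : Equiv.Perm b.Leg)
      (he' : Joins ((Equiv.sumCongr σ.symm τ.symm).trans e))
      {p q r : ℤ} (h : p + q = r) (x : Expr hmn P a p) (y : Expr hmn P b q) :
      Rel hmn P (comp hg e he h (act σ x) (act τ y)) (comp hg _ he' h x y)
  | comp_act_out {a b c : StablePair n} (hg : c.g = a.g + b.g)
      (e : a.Leg ⊕ b.Leg ≃ c.Leg ⊕ Bool) (he : Joins e) (σ : Equiv.Perm c.Leg)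
      (he' : Joins (e.trans (Equiv.sumCongr σ.symm (Equiv.refl Bool))))
      {p q r : ℤ} (h : p + q = r) (x : Expr hmn P a p) (y : Expr hmn P b q) :
      Rel hmn P (act σ (comp hg e he h x y)) (comp hg _ he' h x y)
  | contr_act_in {a c : StablePair n} {p : ℤ} (hg : c.g = a.g + 1) (e : a.Leg ≃ c.Leg ⊕ Bool)
      (σ : Equiv.Perm a.Leg) (x : Expr hmn P a p) :
      Rel hmn P (contr hg e (act σ x)) (contr hg (σ.symm.trans e) x)
  | contr_act_out {a c : StablePair n} {p : ℤ} (hg : c.g = a.g + 1) (e : a.Leg ≃ c.Leg ⊕ Bool)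
      (σ : Equiv.Perm c.Leg) (x : Expr hmn P a p) :
      Rel hmn P (act σ (contr hg e x))
        (contr hg (e.trans (Equiv.sumCongr σ.symm (Equiv.refl Bool))) x)
  | comp_comm {a b c : StablePair n} (hg : c.g = a.g + b.g) (hg' : c.g = b.g + a.g)
      (e : a.Leg ⊕ b.Leg ≃ c.Leg ⊕ Bool) (he : Joins e)
      (he' : Joins (((Equiv.sumComm b.Leg a.Leg).trans e).trans (flipEdge c.Leg)))
      {p q r : ℤ} (h : p + q = r) (h' : q + p = r) (x : Expr hmn P a p) (y : Expr hmn P b q) :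
      Rel hmn P (comp hg e he h x y) (smul (koszul k (p * q)) (comp hg' _ he' h' y x))
  | contr_comm {a c : StablePair n} {p : ℤ} (hg : c.g = a.g + 1) (e : a.Leg ≃ c.Leg ⊕ Bool) (x : Expr hmn P a p) :
      Rel hmn P (contr hg (e.trans (flipEdge c.Leg)) x) (contr hg e x)
  | comp_assoc {a b c ab bc t : StablePair n}
      (hab : ab.g = a.g + b.g) (ht : t.g = ab.g + c.g)
      (hbc : bc.g = b.g + c.g) (ht' : t.g = a.g + bc.g)
      (e : a.Leg ⊕ b.Leg ≃ ab.Leg ⊕ Bool) (f : ab.Leg ⊕ c.Leg ≃ t.Leg ⊕ Bool)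
      (e' : b.Leg ⊕ c.Leg ≃ bc.Leg ⊕ Bool) (f' : a.Leg ⊕ bc.Leg ≃ t.Leg ⊕ Bool)
      (he : Joins e) (hf : Joins f) (he' : Joins e') (hf' : Joins f')
      (_ : ∀ i, bothGluings (f ∘ Sum.inl) (e (Sum.inl i)) =
        swapEdges (secondGluing (f' (Sum.inl i))))
      (_ : ∀ i, bothGluings (f ∘ Sum.inl) (e (Sum.inr i)) =
        swapEdges (bothGluings (f' ∘ Sum.inr) (e' (Sum.inl i))))
      (_ : ∀ i, secondGluing (f (Sum.inr i)) =
        swapEdges (bothGluings (f' ∘ Sum.inr) (e' (Sum.inr i))))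
      {p q r pq qr s : ℤ} (h₁ : p + q = pq) (h₂ : pq + r = s) (h₃ : q + r = qr) (h₄ : p + qr = s)
      (x : Expr hmn P a p) (y : Expr hmn P b q) (z : Expr hmn P c r) :
      Rel hmn P (comp ht f hf h₂ (comp hab e he h₁ x y) z)
        (comp ht' f' hf' h₄ x (comp hbc e' he' h₃ y z))
  | contr_contr {a b b' c : StablePair n} (h₁ : b.g = a.g + 1) (h₂ : c.g = b.g + 1)
      (h₃ : b'.g = a.g + 1) (h₄ : c.g = b'.g + 1)
      (e : a.Leg ≃ b.Leg ⊕ Bool) (f : b.Leg ≃ c.Leg ⊕ Bool)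
      (e' : a.Leg ≃ b'.Leg ⊕ Bool) (f' : b'.Leg ≃ c.Leg ⊕ Bool)
      (_ : ∀ i, bothGluings f (e i) = swapEdges (bothGluings f' (e' i)))
      {p : ℤ} (x : Expr hmn P a p) :
      Rel hmn P (contr h₂ f (contr h₁ e x)) (contr h₄ f' (contr h₃ e' x))
  | contr_comp_left {a b ab a' t : StablePair n} (h₁ : ab.g = a.g + b.g) (h₂ : t.g = ab.g + 1)
      (h₃ : a'.g = a.g + 1) (h₄ : t.g = a'.g + b.g)
      (e : a.Leg ⊕ b.Leg ≃ ab.Leg ⊕ Bool) (f : ab.Leg ≃ t.Leg ⊕ Bool)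
      (e' : a.Leg ≃ a'.Leg ⊕ Bool) (f' : a'.Leg ⊕ b.Leg ≃ t.Leg ⊕ Bool)
      (he : Joins e) (hf' : Joins f')
      (_ : ∀ i, bothGluings f (e (Sum.inl i)) = swapEdges (bothGluings (f' ∘ Sum.inl) (e' i)))
      (_ : ∀ i, bothGluings f (e (Sum.inr i)) = swapEdges (secondGluing (f' (Sum.inr i))))
      {p q r : ℤ} (h : p + q = r) (x : Expr hmn P a p) (y : Expr hmn P b q) :
      Rel hmn P (contr h₂ f (comp h₁ e he h x y)) (comp h₄ f' hf' h (contr h₃ e' x) y)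
  | contr_comp {a b ab ab' t : StablePair n} (h₁ : ab.g = a.g + b.g) (h₂ : t.g = ab.g + 1)
      (h₃ : ab'.g = a.g + b.g) (h₄ : t.g = ab'.g + 1)
      (e : a.Leg ⊕ b.Leg ≃ ab.Leg ⊕ Bool) (f : ab.Leg ≃ t.Leg ⊕ Bool)
      (e' : a.Leg ⊕ b.Leg ≃ ab'.Leg ⊕ Bool) (f' : ab'.Leg ≃ t.Leg ⊕ Bool)
      (he : Joins e) (he' : Joins e')
      (_ : ∀ i, bothGluings f (e i) = swapEdges (bothGluings f' (e' i)))
      {p q r : ℤ} (h : p + q = r) (x : Expr hmn P a p) (y : Expr hmn P b q) :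
      Rel hmn P (contr h₂ f (comp h₁ e he h x y)) (contr h₄ f' (comp h₃ e' he' h x y))
  -- relations of `P`
  | of_add {a : StablePair m} {p : ℤ} (x y : (P.X a).X p) :
      Rel hmn P (of a p (x + y)) (add (of a p x) (of a p y))
  | of_smul {a : StablePair m} {p : ℤ} (s : k) (x : (P.X a).X p) :
      Rel hmn P (of a p (s • x)) (smul s (of a p x))
  | of_d {a : StablePair m} {p : ℤ} (p' : ℤ) (x : (P.X a).X p) :
      Rel hmn P (of a p' ((P.X a).d p p' x)) (d p' (of a p x))
  | of_act {a : StablePair m} {p : ℤ} (σ : Equiv.Perm a.Leg) (x : (P.X a).X p) :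
      Rel hmn P (of a p ((P.act a σ).f p x)) (act (a := a.incl hmn) σ (of a p x))
  | of_contr {a c : StablePair m} {p : ℤ} (hg : c.g = a.g + 1) (e : a.Leg ≃ c.Leg ⊕ Bool)
      (x : (P.X a).X p) :
      Rel hmn P (of c p ((P.contr hg e).f p x))
        (contr (a := a.incl hmn) (c := c.incl hmn) hg e (of a p x))
  | of_comp {a b c : StablePair m} {p q r : ℤ} (hg : c.g = a.g + b.g)
      (e : a.Leg ⊕ b.Leg ≃ c.Leg ⊕ Bool) (he : Joins e) (h : p + q = r)
      (x : (P.X a).X p) (y : (P.X b).X q) :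
      Rel hmn P (of c r (P.comp hg e he h x y))
        (comp (a := a.incl hmn) (b := b.incl hmn) (c := c.incl hmn) hg e he h
          (of a p x) (of b q y))

open _root_.ModularOperad.Expr

def exprSetoid (hmn : m ≤ n) (P : ModularOperad k m) (a : StablePair n) (p : ℤ) :
    Setoid (Expr hmn P a p) :=
  ⟨Rel hmn P, Rel.refl, Rel.symm, Rel.trans⟩

/-- Degree `p` of `(t_! P)((g, l))`. -/
def FreeExt (hmn : m ≤ n) (P : ModularOperad k m) (a : StablePair n) (p : ℤ) : Type u :=
  Quotient (exprSetoid hmn P a p)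

namespace FreeExt

variable {hmn : m ≤ n} {P : ModularOperad k m} {a b c : StablePair n} {p q r : ℤ}

def mk (x : Expr hmn P a p) : FreeExt hmn P a p := Quotient.mk (exprSetoid hmn P a p) x

theorem sound {x y : Expr hmn P a p} (h : Rel hmn P x y) : mk x = mk y :=
  Quotient.sound (s := exprSetoid hmn P a p) h

theorem ind {motive : FreeExt hmn P a p → Prop} (h : ∀ x, motive (mk x)) (x) : motive x :=
  Quotient.inductionOn x h

instance : Zero (FreeExt hmn P a p) := ⟨mk zero⟩
instance : Add (FreeExt hmn P a p) :=
  ⟨Quotient.map₂ add fun _ _ h _ _ h' => Rel.add_congr h h'⟩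
instance : SMul k (FreeExt hmn P a p) :=
  ⟨fun s => Quotient.map (smul s) fun _ _ h => Rel.smul_congr s h⟩

theorem mk_zero : (mk zero : FreeExt hmn P a p) = 0 := rfl
theorem mk_add (x y : Expr hmn P a p) : mk (add x y) = mk x + mk y := rfl
theorem mk_smul (s : k) (x : Expr hmn P a p) : mk (smul s x) = s • mk x := rfl

private theorem zero_add' (x : FreeExt hmn P a p) : 0 + x = x := by
  induction x using ind; exact sound (.zero_add _)

private theorem add_comm' (x y : FreeExt hmn P a p) : x + y = y + x := by
  induction x using ind; induction y using ind; exact sound (.add_comm _ _)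

private theorem zero_smul' (x : FreeExt hmn P a p) : (0 : k) • x = 0 := by
  induction x using ind; exact sound (.zero_smul _)

private theorem one_smul' (x : FreeExt hmn P a p) : (1 : k) • x = x := by
  induction x using ind; exact sound (.one_smul _)

private theorem add_smul' (s t : k) (x : FreeExt hmn P a p) :
    (s + t) • x = s • x + t • x := by
  induction x using ind; exact sound (.add_smul _ _ _)

private theorem mul_smul' (s t : k) (x : FreeExt hmn P a p) :
    (s * t) • x = s • t • x := by
  induction x using ind; exact sound (.mul_smul _ _ _)

private theorem smul_add' (s : k) (x y : FreeExt hmn P a p) :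
    s • (x + y) = s • x + s • y := by
  induction x using ind; induction y using ind; exact sound (.smul_add _ _ _)

instance : Neg (FreeExt hmn P a p) := ⟨fun x => (-1 : k) • x⟩

instance : AddCommGroup (FreeExt hmn P a p) where
  add_assoc x y z := by
    induction x using ind; induction y using ind; induction z using ind
    exact sound (.add_assoc _ _ _)
  zero_add := zero_add'
  add_zero x := by rw [add_comm', zero_add']
  add_comm := add_comm'
  nsmul := nsmulRec
  zsmul := zsmulRec
  neg_add_cancel x := by
    change (-1 : k) • x + x = 0
    conv_lhs => rw [← one_smul' x]
    rw [← mul_smul', ← add_smul', mul_one, neg_add_cancel, zero_smul']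

instance : Module k (FreeExt hmn P a p) where
  one_smul := one_smul'
  mul_smul := mul_smul'
  smul_add := smul_add'
  add_smul := add_smul'
  zero_smul := zero_smul'
  smul_zero s := by
    rw [← zero_smul' (0 : FreeExt hmn P a p), ← mul_smul', mul_zero]

def d (p' : ℤ) : FreeExt hmn P a p →ₗ[k] FreeExt hmn P a p' where
  toFun := Quotient.map (Expr.d p') fun _ _ h => Rel.d_congr p' h
  map_add' x y := by
    induction x using ind; induction y using ind; exact sound (.d_add _ _ _)
  map_smul' s x := by induction x using ind; exact sound (.d_smul _ _ _)

def act (σ : Equiv.Perm a.Leg) : FreeExt hmn P a p →ₗ[k] FreeExt hmn P a p where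
  toFun := Quotient.map (Expr.act σ) fun _ _ h => Rel.act_congr σ h
  map_add' x y := by
    induction x using ind; induction y using ind; exact sound (.act_add _ _ _)
  map_smul' s x := by induction x using ind; exact sound (.act_smul _ _ _)

def contr (hg : c.g = a.g + 1) (e : a.Leg ≃ c.Leg ⊕ Bool) :
    FreeExt hmn P a p →ₗ[k] FreeExt hmn P c p where
  toFun := Quotient.map (Expr.contr hg e) fun _ _ h => Rel.contr_congr hg e h
  map_add' x y := by
    induction x using ind; induction y using ind; exact sound (.contr_add _ _ _ _)
  map_smul' s x := by induction x using ind; exact sound (.contr_smul _ _ _ _)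

def comp (hg : c.g = a.g + b.g) (e : a.Leg ⊕ b.Leg ≃ c.Leg ⊕ Bool) (he : Joins e)
    (h : p + q = r) :
    FreeExt hmn P a p →ₗ[k] FreeExt hmn P b q →ₗ[k] FreeExt hmn P c r :=
  LinearMap.mk₂ k
    (Quotient.map₂ (Expr.comp hg e he h) fun _ _ h₁ _ _ h₂ => Rel.comp_congr hg e he h h₁ h₂)
    (fun x x' y => by
      induction x using ind; induction x' using ind; induction y using ind
      exact sound (.comp_add_left _ _ _ _ _ _ _))
    (fun s x y => by
      induction x using ind; induction y using ind
      exact sound (.comp_smul_left _ _ _ _ _ _ _))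
    (fun x y y' => by
      induction x using ind; induction y using ind; induction y' using ind
      exact sound (.comp_add_right _ _ _ _ _ _ _))
    (fun s x y => by
      induction x using ind; induction y using ind
      exact sound (.comp_smul_right _ _ _ _ _ _ _))

variable (hmn P) in
/-- The complex `(t_! P)((g, l))`. -/
@[simps]
def complex (a : StablePair n) : ChainComplex (ModuleCat.{u} k) ℤ where
  X p := ModuleCat.of k (FreeExt hmn P a p)
  d p p' := ModuleCat.ofHom (d p')
  shape p p' h := by
    ext x
    induction x using ind
    exact sound (.d_shape _ h _)
  d_comp_d' p p' p'' _ _ := by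
    ext x
    induction x using ind
    exact sound (.d_d _ _ _)

end FreeExt

/-- The dg modular operad `t_! P`. -/
def extend (hmn : m ≤ n) (P : ModularOperad k m) : ModularOperad k n where
  X := FreeExt.complex hmn P
  act a σ :=
    { f := fun p => ModuleCat.ofHom (FreeExt.act σ)
      comm' := fun p p' _ => by
        ext x
        induction x using FreeExt.ind
        exact FreeExt.sound (.act_d _ _ _) }
  contr hg e :=
    { f := fun p => ModuleCat.ofHom (FreeExt.contr hg e)
      comm' := fun p p' _ => by
        ext x
        induction x using FreeExt.ind
        exact FreeExt.sound (.contr_d _ _ _ _) }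
  comp hg e he p q r h := FreeExt.comp hg e he h
  act_one a := by
    ext p x
    induction x using FreeExt.ind
    exact FreeExt.sound (.act_one _)
  act_mul a σ τ := by
    ext p x
    induction x using FreeExt.ind
    exact FreeExt.sound (.act_mul _ _ _)
  comp_d hg e he p q r p' q' r' h h₁ h₂ h₃ x y := by
    induction x using FreeExt.ind
    induction y using FreeExt.ind
    exact FreeExt.sound (.comp_d _ _ _ _ h₁ h₂ h₃ _ _)
  comp_act_in hg e he σ τ he' p q r h x y := by
    induction x using FreeExt.ind
    induction y using FreeExt.ind
    exact FreeExt.sound (.comp_act_in _ _ _ _ _ _ _ _ _)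
  comp_act_out hg e he σ he' p q r h x y := by
    induction x using FreeExt.ind
    induction y using FreeExt.ind
    exact FreeExt.sound (.comp_act_out _ _ _ _ _ _ _ _)
  contr_act_in hg e σ := by
    ext p x
    induction x using FreeExt.ind
    exact FreeExt.sound (.contr_act_in _ _ _ _)
  contr_act_out hg e σ := by
    ext p x
    induction x using FreeExt.ind
    exact FreeExt.sound (.contr_act_out _ _ _ _)
  comp_comm hg hg' e he he' p q r h h' x y := by
    induction x using FreeExt.ind
    induction y using FreeExt.ind
    exact FreeExt.sound (.comp_comm _ _ _ _ _ _ _ _ _)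
  contr_comm hg e := by
    ext p x
    induction x using FreeExt.ind
    exact FreeExt.sound (.contr_comm _ _ _)
  comp_assoc _ _ _ _ _ _ _ _ _ _ _ _ h h' h'' _ _ _ _ _ _ _ _ _ _ x y z := by
    induction x using FreeExt.ind
    induction y using FreeExt.ind
    induction z using FreeExt.ind
    exact FreeExt.sound (.comp_assoc _ _ _ _ _ _ _ _ _ _ _ _ h h' h'' _ _ _ _ _ _ _)
  contr_contr _ _ _ _ _ _ _ _ h := by
    ext p x
    induction x using FreeExt.ind
    exact FreeExt.sound (.contr_contr _ _ _ _ _ _ _ _ h _)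
  contr_comp_left _ _ _ _ _ _ _ _ _ _ h h' _ _ _ _ x y := by
    induction x using FreeExt.ind
    induction y using FreeExt.ind
    exact FreeExt.sound (.contr_comp_left _ _ _ _ _ _ _ _ _ _ h h' _ _ _)
  contr_comp _ _ _ _ _ _ _ _ _ _ h _ _ _ _ x y := by
    induction x using FreeExt.ind
    induction y using FreeExt.ind
    exact FreeExt.sound (.contr_comp _ _ _ _ _ _ _ _ _ _ h _ _ _)

/-- The unit `P ⟶ t_m t_! P`. -/
def extendUnit (hmn : m ≤ n) (P : ModularOperad k m) : P ⟶ (trunc k hmn).obj (extend hmn P) where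
  app a :=
    { f := fun p => ModuleCat.ofHom
        { toFun := fun x => FreeExt.mk (of a p x)
          map_add' := fun x y => FreeExt.sound (.of_add x y)
          map_smul' := fun s x => FreeExt.sound (.of_smul s x) }
      comm' := fun p p' _ => by
        ext x
        exact (FreeExt.sound (.of_d p' x)).symm }
  act a σ := by
    ext p x
    exact FreeExt.sound (.of_act σ x)
  contr hg e := by
    ext p x
    exact FreeExt.sound (.of_contr hg e x)
  comp hg e he p q r h x y := FreeExt.sound (.of_comp hg e he h x y)

variable {hmn : m ≤ n} {P : ModularOperad k m} {Q : ModularOperad k n}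

/-- Evaluation of formal expressions. -/
def Expr.eval (f : P ⟶ (trunc k hmn).obj Q) :
    ∀ {a : StablePair n} {p : ℤ}, Expr hmn P a p → (Q.X a).X p
  | _, _, .of a p x => (f.app a).f p x
  | _, _, .zero => 0
  | _, _, .add x y => eval f x + eval f y
  | _, _, .smul s x => s • eval f x
  | a, _, .d (p := p) p' x => (Q.X a).d p p' (eval f x)
  | a, p, .act σ x => (Q.act a σ).f p (eval f x)
  | _, p, .contr hg e x => (Q.contr hg e).f p (eval f x)
  | _, _, .comp hg e he h x y => Q.comp hg e he h (eval f x) (eval f y)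

theorem Expr.eval_rel (f : P ⟶ (trunc k hmn).obj Q) {a : StablePair n} {p : ℤ}
    {x y : Expr hmn P a p} (h : Rel hmn P x y) : eval f x = eval f y := by
  induction h with
  | refl => rfl
  | symm _ ih => exact ih.symm
  | trans _ _ ih ih' => exact ih.trans ih'
  | add_congr _ _ ih ih' => simp only [eval, ih, ih']
  | smul_congr _ _ ih => simp only [eval, ih]
  | d_congr _ _ ih => simp only [eval, ih]
  | act_congr _ _ ih => simp only [eval, ih]
  | contr_congr _ _ _ ih => simp only [eval, ih]
  | comp_congr _ _ _ _ _ _ ih ih' => simp only [eval, ih, ih']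
  | add_assoc => simp only [eval, _root_.add_assoc]
  | add_comm => simp only [eval]; exact _root_.add_comm _ _
  | zero_add => simp only [eval, _root_.zero_add]
  | smul_add => simp only [eval, _root_.smul_add]
  | add_smul => simp only [eval, _root_.add_smul]
  | mul_smul => simp only [eval, SemigroupAction.mul_smul]
  | one_smul => simp only [eval, _root_.one_smul]
  | zero_smul => simp only [eval, _root_.zero_smul]
  | d_add => simp only [eval, map_add]
  | d_smul => simp only [eval, map_smul]
  | act_add => simp only [eval, map_add]
  | act_smul => simp only [eval, map_smul]
  | contr_add => simp only [eval, map_add]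
  | contr_smul => simp only [eval, map_smul]
  | comp_add_left => simp only [eval, map_add, LinearMap.add_apply]
  | comp_smul_left => simp only [eval, map_smul, LinearMap.smul_apply]
  | comp_add_right => simp only [eval, map_add]
  | comp_smul_right => simp only [eval, map_smul]
  | d_shape p' h => simp only [eval]; rw [(Q.X _).shape _ _ h]; rfl
  | d_d => simp only [eval]; rw [← ConcreteCategory.comp_apply, HomologicalComplex.d_comp_d]; rfl
  | act_d => simp only [eval]; rw [← ConcreteCategory.comp_apply, ← ConcreteCategory.comp_apply,
      HomologicalComplex.Hom.comm]
  | contr_d => simp only [eval]; rw [← ConcreteCategory.comp_apply, ← ConcreteCategory.comp_apply,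
      HomologicalComplex.Hom.comm]
  | comp_d _ _ _ _ h₁ h₂ h₃ => simp only [eval]; exact Q.comp_d _ _ _ _ h₁ h₂ h₃ _ _
  | act_one => simp only [eval]; rw [Q.act_one]; rfl
  | act_mul => simp only [eval]; rw [Q.act_mul]; rfl
  | comp_act_in => simp only [eval]; exact Q.comp_act_in _ _ _ _ _ _ _ _ _
  | comp_act_out => simp only [eval]; exact Q.comp_act_out _ _ _ _ _ _ _ _
  | contr_act_in => simp only [eval]; rw [← Q.contr_act_in]; rfl
  | contr_act_out => simp only [eval]; rw [← Q.contr_act_out]; rfl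
  | comp_comm => simp only [eval]; exact Q.comp_comm _ _ _ _ _ _ _ _ _
  | contr_comm => simp only [eval]; rw [Q.contr_comm]
  | comp_assoc _ _ _ _ _ _ _ _ _ _ _ _ h h' h'' =>
    simp only [eval]; exact Q.comp_assoc _ _ _ _ _ _ _ _ _ _ _ _ h h' h'' _ _ _ _ _ _ _
  | contr_contr _ _ _ _ _ _ _ _ h =>
    simp only [eval]
    rw [← ConcreteCategory.comp_apply, ← ConcreteCategory.comp_apply, ← HomologicalComplex.comp_f,
      ← HomologicalComplex.comp_f, Q.contr_contr _ _ _ _ _ _ _ _ h]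
  | contr_comp_left _ _ _ _ _ _ _ _ _ _ h h' =>
    simp only [eval]; exact Q.contr_comp_left _ _ _ _ _ _ _ _ _ _ h h' _ _ _
  | contr_comp _ _ _ _ _ _ _ _ _ _ h =>
    simp only [eval]; exact Q.contr_comp _ _ _ _ _ _ _ _ _ _ h _ _ _
  | of_add => simp only [eval]; exact map_add ((f.app _).f _).hom _ _
  | of_smul => simp only [eval]; exact map_smul ((f.app _).f _).hom _ _
  | of_d =>
    simp only [eval]
    exact (ConcreteCategory.congr_hom ((f.app _).comm _ _) _).symm
  | of_act σ x =>
    simp only [eval]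
    exact ConcreteCategory.congr_hom (HomologicalComplex.congr_hom (f.act _ σ) _) x
  | of_contr hg e x =>
    simp only [eval]
    exact ConcreteCategory.congr_hom (HomologicalComplex.congr_hom (f.contr hg e) _) x
  | of_comp hg e he h x y => simp only [eval]; exact f.comp hg e he h x y

/-- The morphism `t_! P ⟶ Q` corresponding to `f : P ⟶ t_m Q`. -/
def extendLift (f : P ⟶ (trunc k hmn).obj Q) : extend hmn P ⟶ Q where
  app a :=
    { f := fun p => ModuleCat.ofHom
        { toFun := fun x => Quotient.lift (s := exprSetoid hmn P a p) (Expr.eval f)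
            (fun _ _ h => eval_rel f h) x
          map_add' := fun x y => by
            induction x using FreeExt.ind; induction y using FreeExt.ind; rfl
          map_smul' := fun s x => by
            induction x using FreeExt.ind; rfl }
      comm' := fun p p' _ => by
        ext x
        induction x using FreeExt.ind
        rfl }
  act a σ := by
    ext p x
    induction x using FreeExt.ind
    rfl
  contr hg e := by
    ext p x
    induction x using FreeExt.ind
    rfl
  comp hg e he p q r h x y := by
    induction x using FreeExt.ind
    induction y using FreeExt.ind
    rfl

/-- `Hom(t_! P, Q) ≃ Hom(P, t_m Q)`. -/
def extendEquiv (hmn : m ≤ n) (P : ModularOperad k m) (Q : ModularOperad k n) :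
    (extend hmn P ⟶ Q) ≃ (P ⟶ (trunc k hmn).obj Q) where
  toFun φ := extendUnit hmn P ≫ (trunc k hmn).map φ
  invFun := extendLift
  left_inv φ := by
    ext a p x
    induction x using FreeExt.ind with
    | h x =>
    change Expr.eval _ x = (φ.app a).f p (FreeExt.mk x)
    induction x with
    | of a p x => rfl
    | zero => exact (map_zero ((φ.app _).f _).hom).symm
    | add x y ihx ihy =>
      rw [Expr.eval, ihx, ihy]; exact (map_add ((φ.app _).f _).hom _ _).symm
    | smul s x ih => rw [Expr.eval, ih]; exact (map_smul ((φ.app _).f _).hom _ _).symm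
    | d p' x ih =>
      rw [Expr.eval, ih]
      exact ConcreteCategory.congr_hom ((φ.app _).comm _ p') (FreeExt.mk x)
    | act σ x ih =>
      rw [Expr.eval, ih]
      exact (ConcreteCategory.congr_hom (HomologicalComplex.congr_hom (φ.act _ σ) _)
        (FreeExt.mk x)).symm
    | contr hg e x ih =>
      rw [Expr.eval, ih]
      exact (ConcreteCategory.congr_hom (HomologicalComplex.congr_hom (φ.contr hg e) _)
        (FreeExt.mk x)).symm
    | comp hg e he h x y ihx ihy =>
      rw [Expr.eval, ihx, ihy]
      exact (φ.comp hg e he h (FreeExt.mk x) (FreeExt.mk y)).symm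
  right_inv f := by
    ext a p x
    rfl

/-- The functor `t_!`. -/
noncomputable def tShriek (k : Type u) [Field k] {m n : WithTop ℤ} (hmn : m ≤ n) :
    ModularOperad k m ⥤ ModularOperad k n :=
  Adjunction.leftAdjointOfEquiv (G := trunc k hmn) (extendEquiv hmn) (fun _ _ _ _ _ => rfl)

/-- `t_!` is left adjoint to the truncation functor. -/
noncomputable def tShriekAdj (k : Type u) [Field k] {m n : WithTop ℤ} (hmn : m ≤ n) :
    tShriek k hmn ⊣ trunc k hmn :=
  Adjunction.adjunctionOfEquivLeft (G := trunc k hmn) (extendEquiv hmn) (fun _ _ _ _ _ => rfl)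

end LeftAdjoint

/-! ### The canonical tower, principal extensions, minimal models -/

/-- `t_! t_n M`. -/
noncomputable abbrev stage (M : ModularOperad k ⊤) (n : ℤ) : ModularOperad k ⊤ :=
  (tShriek k (le_top : (n : WithTop ℤ) ≤ ⊤)).obj ((trunc k le_top).obj M)

/-- The canonical morphism `t_! t_n M ⟶ M`, the counit of the adjunction. -/
noncomputable def stageCounit (M : ModularOperad k ⊤) (n : ℤ) : M.stage n ⟶ M :=
  (tShriekAdj k (le_top : (n : WithTop ℤ) ≤ ⊤)).counit.app M

/-- The canonical morphism `t_! t_m M ⟶ t_! t_n M`, `m ≤ n`, of the canonical tower: it is adjoint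
to the truncation `t_m M ⟶ t_m t_! t_n M` of the unit `t_n M ⟶ t_n t_! t_n M`. -/
noncomputable def stageMap (M : ModularOperad k ⊤) {m n : ℤ} (h : m ≤ n) : M.stage m ⟶ M.stage n :=
  ((tShriekAdj k (le_top : (m : WithTop ℤ) ≤ ⊤)).homEquiv _ _).symm
    ((trunc k (WithTop.coe_le_coe.2 h)).map
      ((tShriekAdj k (le_top : (n : WithTop ℤ) ≤ ⊤)).unit.app ((trunc k le_top).obj M)))

/-- Homogeneous maps of degree `-s` of graded modular `Σ`-modules, with no
compatibility with the differentials. -/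
structure GradedMap (V W : ModularModule k n) (s : ℤ) where
  app : ∀ (a : StablePair n) {i j : ℤ}, j + s = i → ((V.X a).X i →ₗ[k] (W.X a).X j)
  act : ∀ a (σ : Equiv.Perm a.Leg) {i j : ℤ} (h : j + s = i) (x : (V.X a).X i),
    app a h ((V.act a σ).f i x) = (W.act a σ).f j (app a h x)

/-- `V` is concentrated in modular dimension `d` and has zero differential. -/
def IsPureOfDim (V : ModularModule k n) (d : ℤ) : Prop :=
  (∀ a : StablePair n, a.dim ≠ d → ∀ i, Subsingleton ((V.X a).X i)) ∧
    ∀ a i j, (V.X a).d i j = 0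

/-- A morphism `ξ : V[-1] ⟶ U P` of dg modular `Σ`-modules.  Here `V[-1]_j = V_{j+1}` and the
differential of `V[-1]` is `-d_V`. -/
def IsAttaching {V : ModularModule k n} {P : ModularOperad k n}
    (ξ : GradedMap V P.toModularModule 1) : Prop :=
  ∀ (a : StablePair n) {i j l : ℤ} (h : j + 1 = i) (h' : l + 1 = j) (x : (V.X a).X i),
    (P.X a).d j l (ξ.app a h x) = - ξ.app a h' ((V.X a).d i j x)

/-- The equation `d_Q g - g d_V = f ξ`, for a morphism `f : P ⟶ Q` and a
homogeneous map `g : V ⟶ U Q` of degree `0`. -/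
def IsCompatible {V : ModularModule k n} {P Q : ModularOperad k n}
    (ξ : GradedMap V P.toModularModule 1) (f : P ⟶ Q) (g : GradedMap V Q.toModularModule 0) :
    Prop :=
  ∀ (a : StablePair n) {i j : ℤ} (h : j + 1 = i) (x : (V.X a).X i),
    (Q.X a).d i j (g.app a (add_zero i) x) - g.app a (add_zero j) ((V.X a).d i j x) =
      (f.app a).f j (ξ.app a h x)

/-- `ι : P ⟶ R` together with `γ : V ⟶ U R` is the extension `P ⊔_ξ V`: it satisfies
`Hom(R, Q) = {(f, g) ; f ∈ Hom(P, Q), g ∈ Hom(V, U Q)_0, d_Q g - g d_V = f ξ}` for every `Q`. -/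
def IsExtensionBy {V : ModularModule k n} {P R : ModularOperad k n}
    (ξ : GradedMap V P.toModularModule 1) (ι : P ⟶ R) (γ : GradedMap V R.toModularModule 0) :
    Prop :=
  IsCompatible ξ ι γ ∧
    ∀ (Q : ModularOperad k n) (f : P ⟶ Q) (g : GradedMap V Q.toModularModule 0),
      IsCompatible ξ f g →
        ∃! φ : R ⟶ Q, ι ≫ φ = f ∧
          ∀ (a : StablePair n) (i : ℤ) (x : (V.X a).X i),
            (φ.app a).f i (γ.app a (add_zero i) x) = g.app a (add_zero i) x

/-- `ι : P ⟶ R` is a principal extension in modular dimension `d`: up to isomorphism it is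
`P ⟶ P ⊔_ξ V`, where `V` is a dg modular `Σ`-module concentrated in modular dimension `d`, with
zero differential, and `ξ : V[-1] ⟶ P_d` is a morphism of dg modular `Σ`-modules. -/
def IsPrincipalExtension (d : ℤ) {P R : ModularOperad k n} (ι : P ⟶ R) : Prop :=
  ∃ (V : ModularModule k n) (ξ : GradedMap V P.toModularModule 1)
    (γ : GradedMap V R.toModularModule 0),
    IsPureOfDim V d ∧ IsAttaching ξ ∧ IsExtensionBy ξ ι γ

/-- `M` is minimal if its canonical tower
`0 = t_! t_{-1} M ⟶ t_! t_0 M ⟶ t_! t_1 M ⟶ …` is a sequence of principal extensions.  (There are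
no stable pairs of modular dimension `≤ -1`, so `t_{-1} M` and `t_! t_{-1} M` are zero.) -/
def IsMinimal (M : ModularOperad k ⊤) : Prop :=
  ∀ n : ℕ, IsPrincipalExtension (n : ℤ) (M.stageMap (sub_one_lt (n : ℤ)).le)

/-- `M` is the direct limit of its canonical tower. -/
def IsColimitOfTower (M : ModularOperad k ⊤) : Prop :=
  ∀ (Q : ModularOperad k ⊤) (f : ∀ n : ℕ, M.stage n ⟶ Q),
    (∀ (m n : ℕ) (h : (m : ℤ) ≤ n), M.stageMap h ≫ f n = f m) →
      ∃! φ : M ⟶ Q, ∀ n : ℕ, M.stageCounit n ≫ φ = f n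

/-- `ρ : M ⟶ P` is a minimal model of `P`: `M` is minimal and `ρ` is a weak equivalence. -/
def IsMinimalModel {M P : ModularOperad k ⊤} (ρ : M ⟶ P) : Prop :=
  M.IsMinimal ∧ IsWeakEquivalence ρ

end ModularOperad

/-! Gluing raises the modular dimension: a composition of operations of dimensions `d` and `e` has
dimension `d + e + 1`, and a contraction adds `1`. In operads truncated at `n`, an element of
dimension `n` is therefore never the input of an operation. Adjoining generators `V` of dimension
`n` to such an operad `A` amounts to forming `A ⊕ V` with differential `(x, v) ↦ (d x + ξ v, 0)`,
the compositions and contractions being zero on `V` (`twist`). Applying `t_!` turns this into a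
principal extension of full operads (`IsExtensionBy.of_trunc`).

The model is built by induction on the modular dimension. Let `ρ : S ⟶ P`, with `S` freely generated
by its part of dimension `≤ n - 1`. In dimension `n` let `V` be a space of cone cycles `(s, p)`,
that is `d s = 0` and `d p = ρ s`, which represents the homology of the cone of `ρ`; put `ξ (s, p) =
s` and `g (s, p) = p`. Representatives stable under `Σ_l` exist by Maschke's theorem, the only place
where characteristic zero enters (`exists_invariant_isCompl`, `exists_cone_generators`). Adjoining
`V` kills the homology of the cone, so the extended morphism is a quasi-isomorphism in dimension `n`
(`quasiIso_twistDesc`), and lower dimensions do not change (`exists_principalExtension`).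

Iteration from `t_! t_{-1} P` gives a tower which is eventually constant in every dimension
(`exists_tower`). Its limit `towerLimit` reads each `(g, l)` at a stage where it is already stable,
so it maps to `P` by a weak equivalence. Since the stage `n + 1` is freely generated in dimensions
`≤ n`, it is `t_! t_n` of the limit, and the limit is minimal (`isMinimal_towerLimit`).

No normal form for the formal expressions defining `t_!` is needed: truncation also has a right
adjoint, extension by zero, and the adjoint triple gives `t_m t_! ≅ id` (`isIso_tShriekAdj_unit`).
The direct limit property holds for every operad, because a morphism out of it is a compatible
family of morphisms out of its truncations (`isColimitOfTower`). -/

namespace StablePair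

/-! ### Modular dimension under gluing -/

variable {m n : WithTop ℤ}

theorem dim_nonneg (a : StablePair n) : 0 ≤ a.dim := by
  have := a.stable
  unfold dim
  omega

/-- Gluing consumes two legs and adds the genera, so `3g - 3 + l` changes by `3 - 2 = 1`. With
`dim_nonneg`, both inputs have strictly smaller dimension than the output; the whole induction rests
on this. -/
theorem dim_of_comp {a b c : StablePair n} (hg : c.g = a.g + b.g)
    (e : a.Leg ⊕ b.Leg ≃ c.Leg ⊕ Bool) : c.dim = a.dim + b.dim + 1 := by
  have := Fintype.card_congr e
  simp only [Fintype.card_sum, Fintype.card_fin, Fintype.card_bool] at this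
  unfold dim
  omega

theorem dim_of_contr {a c : StablePair n} (hg : c.g = a.g + 1) (e : a.Leg ≃ c.Leg ⊕ Bool) :
    c.dim = a.dim + 1 := by
  have := Fintype.card_congr e
  simp only [Fintype.card_sum, Fintype.card_fin, Fintype.card_bool] at this
  unfold dim
  omega

theorem dim_le (a : StablePair n) : ((a.dim : ℤ) : WithTop ℤ) ≤ n := a.le

/-- A stable pair whose modular dimension satisfies a sharper bound. -/
def restrict (a : StablePair n) (h : (a.dim : WithTop ℤ) ≤ m) : StablePair m :=
  ⟨a.g, a.l, a.stable, h⟩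

theorem le_of_comp_left {a b c : StablePair n} (hg : c.g = a.g + b.g)
    (e : a.Leg ⊕ b.Leg ≃ c.Leg ⊕ Bool) (h : (c.dim : WithTop ℤ) ≤ m) :
    (a.dim : WithTop ℤ) ≤ m :=
  le_trans (WithTop.coe_le_coe.2 (by have := dim_of_comp hg e; have := b.dim_nonneg; omega)) h

theorem le_of_comp_right {a b c : StablePair n} (hg : c.g = a.g + b.g)
    (e : a.Leg ⊕ b.Leg ≃ c.Leg ⊕ Bool) (h : (c.dim : WithTop ℤ) ≤ m) :
    (b.dim : WithTop ℤ) ≤ m :=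
  le_trans (WithTop.coe_le_coe.2 (by have := dim_of_comp hg e; have := a.dim_nonneg; omega)) h

theorem le_of_contr {a c : StablePair n} (hg : c.g = a.g + 1) (e : a.Leg ≃ c.Leg ⊕ Bool)
    (h : (c.dim : WithTop ℤ) ≤ m) : (a.dim : WithTop ℤ) ≤ m :=
  le_trans (WithTop.coe_le_coe.2 (by have := dim_of_contr hg e; omega)) h

end StablePair

namespace ModularOperad

open StablePair

variable {k : Type u} [Field k] {m n : WithTop ℤ}

/-! ### The right adjoint of the truncation functor -/

/-- The complexes of the extension by zero. -/
@[simps]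
def coextendX (B : ModularOperad k m) (a : StablePair n) : ChainComplex (ModuleCat.{u} k) ℤ where
  -- A product indexed by the proofs of `a.dim ≤ m`: it is `B` where the bound holds and the zero
  -- module elsewhere, so the operations need no case distinction.
  X p := ModuleCat.of k
    (∀ h : PLift ((a.dim : WithTop ℤ) ≤ m), (B.X (a.restrict h.down)).X p)
  d p p' := ModuleCat.ofHom
    (LinearMap.pi fun h => ((B.X (a.restrict h.down)).d p p').hom ∘ₗ LinearMap.proj h)
  shape p p' h := ModuleCat.hom_ext <| LinearMap.ext fun x => funext fun h' => by
    change (B.X _).d p p' (x h') = 0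
    rw [(B.X _).shape _ _ h]
    rfl
  d_comp_d' p p' p'' _ _ := ModuleCat.hom_ext <| LinearMap.ext fun x => funext fun h' => by
    change (B.X _).d p' p'' ((B.X _).d p p' (x h')) = 0
    rw [← ConcreteCategory.comp_apply, HomologicalComplex.d_comp_d]
    rfl

/-- The extension by zero of a dg modular operad defined in modular dimensions `≤ m`. -/
def coextend (n : WithTop ℤ) (B : ModularOperad k m) : ModularOperad k n where
  X := coextendX B
  act a σ :=
    { f := fun p => ModuleCat.ofHom
        (LinearMap.pi fun h => ((B.act (a.restrict h.down) σ).f p).hom ∘ₗ LinearMap.proj h)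
      comm' := fun p p' _ => by
        ext x
        funext h
        exact ConcreteCategory.congr_hom ((B.act (a.restrict h.down) σ).comm p p') (x h) }
  -- A bound on the dimension of an output is inherited by the inputs, so an operation may be
  -- evaluated in `B` whenever its output is not in the zero part.
  contr {a c} hg e :=
    { f := fun p => ModuleCat.ofHom
        (LinearMap.pi fun h => ((B.contr (a := a.restrict (le_of_contr hg e h.down))
          (c := c.restrict h.down) hg e).f p).hom ∘ₗ LinearMap.proj ⟨le_of_contr hg e h.down⟩)
      comm' := fun p p' _ => by
        ext x
        funext h
        exact ConcreteCategory.congr_hom ((B.contr (a := a.restrict (le_of_contr hg e h.down))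
          (c := c.restrict h.down) hg e).comm p p') (x _) }
  comp {a b c} hg e he p q r h :=
    LinearMap.mk₂ k (fun x y h' => B.comp (a := a.restrict (le_of_comp_left hg e h'.down))
        (b := b.restrict (le_of_comp_right hg e h'.down)) (c := c.restrict h'.down)
      hg e he h
        (x ⟨le_of_comp_left hg e h'.down⟩) (y ⟨le_of_comp_right hg e h'.down⟩))
      (fun x x' y => by funext h'; exact LinearMap.map_add₂ _ _ _ _)
      (fun s x y => by funext h'; exact LinearMap.map_smul₂ _ _ _ _)
      (fun x y y' => by funext h'; exact map_add _ _ _)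
      (fun s x y => by funext h'; exact map_smul _ _ _)
  act_one a := by
    ext p x
    funext h
    exact ConcreteCategory.congr_hom (HomologicalComplex.congr_hom (B.act_one _) p) (x h)
  act_mul a σ τ := by
    ext p x
    funext h
    exact ConcreteCategory.congr_hom (HomologicalComplex.congr_hom (B.act_mul _ σ τ) p) (x h)
  comp_d {a b c} hg e he p q r p' q' r' h h₁ h₂ h₃ x y := by
    funext h'
    exact B.comp_d (a := a.restrict (le_of_comp_left hg e h'.down))
      (b := b.restrict (le_of_comp_right hg e h'.down)) (c := c.restrict h'.down)
      hg e he h h₁ h₂ h₃ (x _) (y _)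
  comp_act_in {a b c} hg e he σ τ he' p q r h x y := by
    funext h'
    exact B.comp_act_in (a := a.restrict (le_of_comp_left hg e h'.down))
      (b := b.restrict (le_of_comp_right hg e h'.down)) (c := c.restrict h'.down)
      hg e he σ τ he' h (x _) (y _)
  comp_act_out {a b c} hg e he σ he' p q r h x y := by
    funext h'
    exact B.comp_act_out (a := a.restrict (le_of_comp_left hg e h'.down))
      (b := b.restrict (le_of_comp_right hg e h'.down)) (c := c.restrict h'.down)
      hg e he σ he' h (x _) (y _)
  contr_act_in hg e σ := by
    ext p x
    funext h
    exact ConcreteCategory.congr_hom (HomologicalComplex.congr_hom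
      (B.contr_act_in (a := restrict _ (le_of_contr hg e h.down)) (c := restrict _ h.down)
        hg e σ) p) (x _)
  contr_act_out hg e σ := by
    ext p x
    funext h
    exact ConcreteCategory.congr_hom (HomologicalComplex.congr_hom
      (B.contr_act_out (a := restrict _ (le_of_contr hg e h.down)) (c := restrict _ h.down)
        hg e σ) p) (x _)
  comp_comm hg hg' e he he' p q r h h' x y := by
    funext h''
    exact B.comp_comm (a := restrict _ (le_of_comp_left hg e h''.down))
      (b := restrict _ (le_of_comp_right hg e h''.down)) (c := restrict _ h''.down)
      hg hg' e he he' h h' (x _) (y _)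
  contr_comm hg e := by
    ext p x
    funext h
    exact ConcreteCategory.congr_hom (HomologicalComplex.congr_hom
      (B.contr_comm (a := restrict _ (le_of_contr hg e h.down)) (c := restrict _ h.down)
        hg e) p) (x _)
  comp_assoc {a b c ab bc t} hab ht hbc ht' e f e' f' he hf he' hf' h h' h'' _ _ _ _ _ _
      h₁ h₂ h₃ h₄ x y z := by
    funext i
    exact B.comp_assoc
      (a := a.restrict (le_of_comp_left ht' f' i.down))
      (b := b.restrict (le_of_comp_right hab e (le_of_comp_left ht f i.down)))
      (c := c.restrict (le_of_comp_right ht f i.down))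
      (ab := ab.restrict (le_of_comp_left ht f i.down))
      (bc := bc.restrict (le_of_comp_right ht' f' i.down)) (t := t.restrict i.down)
      hab ht hbc ht' e f e' f' he hf he' hf' h h' h'' h₁ h₂ h₃ h₄ (x _) (y _) (z _)
  contr_contr {a b b' c} h₁ h₂ h₃ h₄ e f e' f' h := by
    ext p x
    funext i
    exact ConcreteCategory.congr_hom (HomologicalComplex.congr_hom
      (B.contr_contr (a := a.restrict (le_of_contr h₁ e (le_of_contr h₂ f i.down)))
        (b := b.restrict (le_of_contr h₂ f i.down)) (b' := b'.restrict (le_of_contr h₄ f' i.down))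
        (c := c.restrict i.down) h₁ h₂ h₃ h₄ e f e' f' h) p) (x _)
  contr_comp_left {a b ab a' t} h₁ h₂ h₃ h₄ e f e' f' he hf' h h' p q r h'' x y := by
    funext i
    exact B.contr_comp_left
      (a := a.restrict (le_of_contr h₃ e' (le_of_comp_left h₄ f' i.down)))
      (b := b.restrict (le_of_comp_right h₄ f' i.down))
      (ab := ab.restrict (le_of_contr h₂ f i.down))
      (a' := a'.restrict (le_of_comp_left h₄ f' i.down)) (t := t.restrict i.down)
      h₁ h₂ h₃ h₄ e f e' f' he hf' h h' h'' (x _) (y _)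
  contr_comp {a b ab ab' t} h₁ h₂ h₃ h₄ e f e' f' he he' h p q r h' x y := by
    funext i
    exact B.contr_comp
      (a := a.restrict (le_of_comp_left h₁ e (le_of_contr h₂ f i.down)))
      (b := b.restrict (le_of_comp_right h₁ e (le_of_contr h₂ f i.down)))
      (ab := ab.restrict (le_of_contr h₂ f i.down))
      (ab' := ab'.restrict (le_of_contr h₄ f' i.down)) (t := t.restrict i.down)
      h₁ h₂ h₃ h₄ e f e' f' he he' h h' (x _) (y _)

/-- `Hom(t_m S, B) ≃ Hom(S, t_* B)`. -/
def coextendEquiv (hmn : m ≤ n) (S : ModularOperad k n) (B : ModularOperad k m) :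
    ((trunc k hmn).obj S ⟶ B) ≃ (S ⟶ coextend n B) where
  toFun f :=
    { app := fun a =>
        { f := fun p => ModuleCat.ofHom
            (LinearMap.pi fun h => ((f.app (a.restrict h.down)).f p).hom)
          comm' := fun p p' _ => by
            ext x
            funext h
            exact ConcreteCategory.congr_hom ((f.app (a.restrict h.down)).comm p p') x }
      act := fun a σ => by
        ext p x
        funext h
        exact ConcreteCategory.congr_hom (HomologicalComplex.congr_hom
          (f.act (a.restrict h.down) σ) p) x
      contr := fun {a c} hg e => by
        ext p x
        funext h
        exact ConcreteCategory.congr_hom (HomologicalComplex.congr_hom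
          (f.contr (a := a.restrict (le_of_contr hg e h.down)) (c := c.restrict h.down) hg e) p) x
      comp := fun {a b c} hg e he p q r h x y => by
        funext h'
        exact f.comp (a := a.restrict (le_of_comp_left hg e h'.down))
          (b := b.restrict (le_of_comp_right hg e h'.down)) (c := c.restrict h'.down)
          hg e he h x y }
  invFun g :=
    { app := fun a =>
        { f := fun p => ModuleCat.ofHom
            (LinearMap.proj (R := k) (φ := fun h : PLift (((a.incl hmn).dim : WithTop ℤ) ≤ m) =>
              (B.X ((a.incl hmn).restrict h.down)).X p) ⟨a.le⟩ ∘ₗ ((g.app (a.incl hmn)).f p).hom)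
          comm' := fun p p' _ => by
            ext x
            exact congrFun (ConcreteCategory.congr_hom ((g.app (a.incl hmn)).comm p p') x) ⟨a.le⟩ }
      act := fun a σ => by
        ext p x
        exact congrFun (ConcreteCategory.congr_hom (HomologicalComplex.congr_hom
          (g.act (a.incl hmn) σ) p) x) ⟨a.le⟩
      contr := fun {a c} hg e => by
        ext p x
        exact congrFun (ConcreteCategory.congr_hom (HomologicalComplex.congr_hom
          (g.contr (a := a.incl hmn) (c := c.incl hmn) hg e) p) x) ⟨c.le⟩
      comp := fun {a b c} hg e he p q r h x y =>
        congrFun (g.comp (a := a.incl hmn) (b := b.incl hmn) (c := c.incl hmn) hg e he h x y)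
          ⟨c.le⟩ }
  left_inv f := by
    ext a p x
    rfl
  right_inv g := by
    ext a p x
    rfl

/-- The extension by zero as a functor. -/
def coextendFunctor (k : Type u) [Field k] (hmn : m ≤ n) : ModularOperad k m ⥤ ModularOperad k n :=
  Adjunction.rightAdjointOfEquiv (F := trunc k hmn) (fun S B => coextendEquiv hmn S B)
    (fun _ _ _ _ _ => rfl)

/-- The extension by zero is right adjoint to the truncation functor. -/
def coextendAdj (k : Type u) [Field k] (hmn : m ≤ n) : trunc k hmn ⊣ coextendFunctor k hmn :=
  Adjunction.adjunctionOfEquivRight (F := trunc k hmn) (fun S B => coextendEquiv hmn S B)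
    (fun _ _ _ _ _ => rfl)

/-- The inverses of the components respect the operations because `f` does and is injective. -/
theorem isIso_of_bijective {P Q : ModularOperad k n} (f : P ⟶ Q)
    (hf : ∀ a p, Function.Bijective ((f.app a).f p)) : IsIso f := by
  have (a : StablePair n) : IsIso (f.app a) := by
    have (p : ℤ) : IsIso ((f.app a).f p) := (ConcreteCategory.isIso_iff_bijective _).2 (hf a p)
    exact HomologicalComplex.Hom.isIso_of_components _
  let g : Q ⟶ P :=
    { app := fun a => inv (f.app a)
      act := fun a σ => ?_
      contr := fun hg e => ?_
      comp := fun hg e he p q r h x y => ?_ }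
  · refine ⟨⟨g, ?_, ?_⟩⟩
    · ext1 a
      exact IsIso.hom_inv_id (f.app a)
    · ext1 a
      exact IsIso.inv_hom_id (f.app a)
  · rw [IsIso.eq_inv_comp, ← Category.assoc, ← f.act, Category.assoc, IsIso.hom_inv_id,
      Category.comp_id]
  · rw [IsIso.eq_inv_comp, ← Category.assoc, ← f.contr, Category.assoc, IsIso.hom_inv_id,
      Category.comp_id]
  · apply (hf _ _).1
    have inv_apply (a p) (x : (Q.X a).X p) : (f.app a).f p ((inv (f.app a)).f p x) = x :=
      ConcreteCategory.congr_hom (HomologicalComplex.congr_hom (IsIso.inv_hom_id (f.app a)) p) x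
    rw [inv_apply, f.comp, inv_apply, inv_apply]

/-- In an adjoint triple the unit of the left adjunction is invertible exactly when the counit of
the right one is. The latter is visibly invertible: extending by zero and truncating changes
nothing. Thus freely adding higher dimensions imposes no new relation in dimensions `≤ m`. -/
instance isIso_tShriekAdj_unit (hmn : m ≤ n) : IsIso (tShriekAdj k hmn).unit := by
  refine (Adjunction.Triple.isIso_unit_iff_isIso_counit
    ⟨tShriekAdj k hmn, coextendAdj k hmn⟩).2 ?_
  have (B : ModularOperad k m) : IsIso ((coextendAdj k hmn).counit.app B) := by
    refine isIso_of_bijective _ fun a p => ⟨fun x y h => ?_, fun y => ⟨(fun _ => y : ∀ h, _), rfl⟩⟩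
    funext h'
    exact h
  exact NatIso.isIso_of_isIso_app _

theorem bijective_of_isIso {P Q : ModularOperad k n} (f : P ⟶ Q) [IsIso f] (a p) :
    Function.Bijective ((f.app a).f p) := by
  refine Function.bijective_iff_has_inverse.2 ⟨((inv f).app a).f p, fun x => ?_, fun x => ?_⟩
  · exact ConcreteCategory.congr_hom (HomologicalComplex.congr_hom
      (congrArg (fun φ : P ⟶ P => φ.app a) (IsIso.hom_inv_id f)) p) x
  · exact ConcreteCategory.congr_hom (HomologicalComplex.congr_hom
      (congrArg (fun φ : Q ⟶ Q => φ.app a) (IsIso.inv_hom_id f)) p) x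

/-! ### Operads generated in bounded modular dimension -/

/-- `S` is freely generated by its part of modular dimension `≤ m`. -/
def IsExtendedFrom (hmn : m ≤ n) (S : ModularOperad k n) : Prop :=
  ∀ Q : ModularOperad k n, Function.Bijective
    (fun φ : S ⟶ Q => (trunc k hmn).map φ)

/-- The adjunction bijection, followed by the replacement of `B` by `t_m t_! B` through the
invertible unit. -/
theorem isExtendedFrom_tShriek (hmn : m ≤ n) (B : ModularOperad k m) :
    IsExtendedFrom hmn ((tShriek k hmn).obj B) := by
  intro Q
  have := (((tShriekAdj k hmn).homEquiv B Q).trans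
    ((asIso ((tShriekAdj k hmn).unit.app B)).homFromEquiv)).bijective
  refine (congrArg Function.Bijective (funext fun φ => ?_)).mp this
  simp [Adjunction.homEquiv_unit]

/-- Existence is immediate once a morphism `t_m S ⟶ t_m Q` is known to be determined by its part in
dimensions `≤ l`. For the latter, such a morphism is the same as one from `S` to the extension by
zero of `t_m Q`, to which the hypothesis on `S` applies. -/
theorem IsExtendedFrom.mono {l : WithTop ℤ} {hln : l ≤ n} {S : ModularOperad k n}
    (hS : IsExtendedFrom hln S) (hlm : l ≤ m) (hmn : m ≤ n) : IsExtendedFrom hmn S := by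
  intro Q
  have inj : Function.Injective
      fun φ : (trunc k hmn).obj S ⟶ (trunc k hmn).obj Q => (trunc k hlm).map φ := by
    intro f g hfg
    apply (coextendEquiv hmn _ _).injective
    apply (hS _).1
    ext a p x
    funext h
    exact ConcreteCategory.congr_hom (HomologicalComplex.congr_hom
      (congrArg (fun φ : (trunc k hlm).obj ((trunc k hmn).obj S) ⟶ _ => φ.app a) hfg) p) x
  exact ⟨fun f g h => (hS Q).1 (congrArg (fun φ => (trunc k hlm).map φ) h),
    fun f => by
      obtain ⟨φ, hφ⟩ := (hS Q).2 ((trunc k hlm).map f)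
      exact ⟨φ, inj hφ⟩⟩

/-- The unit at `t_m S` extends to a morphism `c : S ⟶ t_! t_m S`, and the triangle identity makes
it inverse to the counit. This identifies intrinsically generated operads with stages of a canonical
tower. -/
theorem IsExtendedFrom.isIso_counit {hmn : m ≤ n} {S : ModularOperad k n}
    (hS : IsExtendedFrom hmn S) : IsIso ((tShriekAdj k hmn).counit.app S) := by
  obtain ⟨c, hc⟩ := (hS _).2 ((tShriekAdj k hmn).unit.app ((trunc k hmn).obj S))
  replace hc : (trunc k hmn).map c = _ := hc
  refine ⟨⟨c, ?_, ?_⟩⟩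
  · apply ((tShriekAdj k hmn).homEquiv _ _).injective
    rw [Adjunction.homEquiv_unit, Adjunction.homEquiv_unit, Functor.map_comp, ← Category.assoc,
      Adjunction.right_triangle_components, hc]
    simp
  · apply (hS _).1
    change (trunc k hmn).map _ = (trunc k hmn).map _
    rw [Functor.map_comp, hc]
    exact ((tShriekAdj k hmn).right_triangle_components S).trans
      (CategoryTheory.Functor.map_id _ _).symm

end ModularOperad

/-! ### Truncation and extension by zero of homogeneous maps -/

namespace ModularModule

variable {k : Type u} [Field k] {m n : WithTop ℤ}

/-- The truncation of a dg modular `Σ`-module. -/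
def trunc (hmn : m ≤ n) (V : ModularModule k n) : ModularModule k m where
  X a := V.X (a.incl hmn)
  act a := V.act (a.incl hmn)
  act_one a := V.act_one (a.incl hmn)
  act_mul a := V.act_mul (a.incl hmn)

end ModularModule

namespace ModularOperad

open StablePair

variable {k : Type u} [Field k] {m n : WithTop ℤ}

namespace GradedMap

/-- A map of degree `0`, given degreewise. -/
def ofDegreeZero {V W : ModularModule k n} (φ : ∀ a i, (V.X a).X i →ₗ[k] (W.X a).X i)
    (hφ : ∀ a (σ : Equiv.Perm a.Leg) i (x : (V.X a).X i),
      φ a i ((V.act a σ).f i x) = (W.act a σ).f i (φ a i x)) : GradedMap V W 0 where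
  -- Degree `0` relates `i` and `j` only through `j + 0 = i`, hence the transport; at `add_zero j`
  -- it is the identity by reduction.
  app a _ j h := ((add_zero j).symm.trans h) ▸ φ a j
  act a σ i j h x := by
    obtain rfl : j = i := (add_zero j).symm.trans h
    exact hφ a σ j x

/-- The truncation of a homogeneous map. -/
def trunc (hmn : m ≤ n) {V W : ModularModule k n} {s : ℤ} (γ : GradedMap V W s) :
    GradedMap (V.trunc hmn) (W.trunc hmn) s where
  app a _ _ h := γ.app (a.incl hmn) h
  act a σ _ _ h x := γ.act (a.incl hmn) σ h x

/-- Composition of a homogeneous map with a morphism of dg modular operads. -/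
def postcomp {V : ModularModule k n} {P Q : ModularOperad k n} {s : ℤ}
    (γ : GradedMap V P.toModularModule s) (f : P ⟶ Q) : GradedMap V Q.toModularModule s where
  app a _ j h := ((f.app a).f j).hom ∘ₗ γ.app a h
  act a σ i j h x := by
    change (f.app a).f j (γ.app a h _) = _
    rw [γ.act]
    exact ConcreteCategory.congr_hom (HomologicalComplex.congr_hom (f.act a σ) j) _

@[simp]
theorem postcomp_app {V : ModularModule k n} {P Q : ModularOperad k n} {s : ℤ}
    (γ : GradedMap V P.toModularModule s) (f : P ⟶ Q) (a : StablePair n) {i j : ℤ}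
    (h : j + s = i) (x : (V.X a).X i) : (γ.postcomp f).app a h x = (f.app a).f j (γ.app a h x) :=
  rfl

open Classical in
/-- The components of the extension by zero of a homogeneous map. -/
noncomputable def extendApp (hmn : m ≤ n) {V W : ModularModule k n} {s : ℤ}
    (γ : GradedMap (V.trunc hmn) (W.trunc hmn) s) (a : StablePair n) {i j : ℤ} (h : j + s = i) :
    (V.X a).X i →ₗ[k] (W.X a).X j :=
  if ha : (a.dim : WithTop ℤ) ≤ m then γ.app (a.restrict ha) h else 0

theorem extendApp_of_le (hmn : m ≤ n) {V W : ModularModule k n} {s : ℤ}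
    (γ : GradedMap (V.trunc hmn) (W.trunc hmn) s) {a : StablePair n}
    (ha : (a.dim : WithTop ℤ) ≤ m) {i j : ℤ} (h : j + s = i) :
    γ.extendApp hmn a h = γ.app (a.restrict ha) h :=
  dif_pos ha

theorem extendApp_of_not_le (hmn : m ≤ n) {V W : ModularModule k n} {s : ℤ}
    (γ : GradedMap (V.trunc hmn) (W.trunc hmn) s) {a : StablePair n}
    (ha : ¬ (a.dim : WithTop ℤ) ≤ m) {i j : ℤ} (h : j + s = i) :
    γ.extendApp hmn a h = 0 :=
  dif_neg ha

/-- The extension by zero of a homogeneous map. -/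
noncomputable def extend (hmn : m ≤ n) {V W : ModularModule k n} {s : ℤ}
    (γ : GradedMap (V.trunc hmn) (W.trunc hmn) s) : GradedMap V W s where
  app a _ _ h := γ.extendApp hmn a h
  act a σ _ _ h x := by
    by_cases ha : (a.dim : WithTop ℤ) ≤ m
    · rw [extendApp_of_le hmn γ ha]
      exact γ.act (a.restrict ha) σ h x
    · rw [extendApp_of_not_le hmn γ ha]
      exact (map_zero ((W.act a σ).f _).hom).symm

theorem extend_app (hmn : m ≤ n) {V W : ModularModule k n} {s : ℤ}
    (γ : GradedMap (V.trunc hmn) (W.trunc hmn) s) (a : StablePair n)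
    (ha : (a.dim : WithTop ℤ) ≤ m) {i j : ℤ} (h : j + s = i) :
    (γ.extend hmn).app a h = γ.app (a.restrict ha) h :=
  extendApp_of_le hmn γ ha h

end GradedMap

theorem act_d_apply (P : ModularOperad k n) {a : StablePair n} (σ : Equiv.Perm a.Leg) {p : ℤ}
    (p' : ℤ) (x : (P.X a).X p) :
    (P.X a).d p p' ((P.act a σ).f p x) = (P.act a σ).f p' ((P.X a).d p p' x) :=
  ConcreteCategory.congr_hom ((P.act a σ).comm p p') x

theorem contr_d_apply (P : ModularOperad k n) {a c : StablePair n} (hg : c.g = a.g + 1)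
    (e : a.Leg ≃ c.Leg ⊕ Bool) {p : ℤ} (p' : ℤ) (x : (P.X a).X p) :
    (P.X c).d p p' ((P.contr hg e).f p x) = (P.contr hg e).f p' ((P.X a).d p p' x) :=
  ConcreteCategory.congr_hom ((P.contr hg e).comm p p') x

theorem Hom.d_apply {P Q : ModularOperad k n} (f : P ⟶ Q) (a : StablePair n) (i j : ℤ)
    (x : (P.X a).X i) : (Q.X a).d i j ((f.app a).f i x) = (f.app a).f j ((P.X a).d i j x) :=
  ConcreteCategory.congr_hom ((f.app a).comm i j) x

theorem Hom.act_apply {P Q : ModularOperad k n} (f : P ⟶ Q) (a : StablePair n)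
    (σ : Equiv.Perm a.Leg) (i : ℤ) (x : (P.X a).X i) :
    (f.app a).f i ((P.act a σ).f i x) = (Q.act a σ).f i ((f.app a).f i x) :=
  ConcreteCategory.congr_hom (HomologicalComplex.congr_hom (f.act a σ) i) x

theorem Hom.contr_apply {P Q : ModularOperad k n} (f : P ⟶ Q) {a c : StablePair n}
    (hg : c.g = a.g + 1) (e : a.Leg ≃ c.Leg ⊕ Bool) (i : ℤ) (x : (P.X a).X i) :
    (f.app c).f i ((P.contr hg e).f i x) = (Q.contr hg e).f i ((f.app a).f i x) :=
  ConcreteCategory.congr_hom (HomologicalComplex.congr_hom (f.contr hg e) i) x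

theorem d_d_apply (P : ModularOperad k n) (a : StablePair n) (i j l : ℤ) (x : (P.X a).X i) :
    (P.X a).d j l ((P.X a).d i j x) = 0 := by
  rw [← ConcreteCategory.comp_apply, HomologicalComplex.d_comp_d]
  rfl

/-! ### Adjoining generators in the top modular dimension -/

section Twist

variable {n : ℤ} (A : ModularOperad k (n : WithTop ℤ)) {V : ModularModule k (n : WithTop ℤ)}
  (hV : IsPureOfDim V n) {ξ : GradedMap V A.toModularModule 1} (hξ : IsAttaching ξ)

theorem IsPureOfDim.eq_zero {N : WithTop ℤ} {d : ℤ} {V : ModularModule k N}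
    (hV : IsPureOfDim V d) {a : StablePair N} (ha : a.dim ≠ d) {i : ℤ} (v : (V.X a).X i) :
    v = 0 :=
  (hV.1 a ha i).elim _ _

theorem IsPureOfDim.d_apply {N : WithTop ℤ} {d : ℤ} {V : ModularModule k N}
    (hV : IsPureOfDim V d) (a : StablePair N) (i j : ℤ) (v : (V.X a).X i) :
    (V.X a).d i j v = 0 := by
  rw [hV.2]
  rfl

/-- The output has dimension at most `n`, so the input lies strictly below and generators of
dimension `n` cannot be contracted. The two analogues below say the same for compositions. -/
theorem ne_of_contr {a c : StablePair (n : WithTop ℤ)} (hg : c.g = a.g + 1)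
    (e : a.Leg ≃ c.Leg ⊕ Bool) : a.dim ≠ n := by
  have := dim_of_contr hg e
  have := WithTop.coe_le_coe.1 c.dim_le
  omega

theorem ne_of_comp_left {a b c : StablePair (n : WithTop ℤ)} (hg : c.g = a.g + b.g)
    (e : a.Leg ⊕ b.Leg ≃ c.Leg ⊕ Bool) : a.dim ≠ n := by
  have := dim_of_comp hg e
  have := WithTop.coe_le_coe.1 c.dim_le
  have := b.dim_nonneg
  omega

theorem ne_of_comp_right {a b c : StablePair (n : WithTop ℤ)} (hg : c.g = a.g + b.g)
    (e : a.Leg ⊕ b.Leg ≃ c.Leg ⊕ Bool) : b.dim ≠ n := by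
  have := dim_of_comp hg e
  have := WithTop.coe_le_coe.1 c.dim_le
  have := a.dim_nonneg
  omega

/-- The twisted differential `(x, v) ↦ (d x + ξ v, 0)`. -/
def twistD (ξ : GradedMap V A.toModularModule 1) (a : StablePair (n : WithTop ℤ)) (p p' : ℤ) :
    ((A.X a).X p × (V.X a).X p) →ₗ[k] ((A.X a).X p' × (V.X a).X p') :=
  LinearMap.inl k _ _ ∘ₗ
    -- The value `0` in the other degrees makes this the differential of a chain complex.
    ((A.X a).d p p').hom.coprod (if h : p' + 1 = p then ξ.app a h else 0)

variable {A} in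
theorem twistD_apply (ξ : GradedMap V A.toModularModule 1) (a : StablePair (n : WithTop ℤ))
    {p p' : ℤ} (h : p' + 1 = p) (x : (A.X a).X p × (V.X a).X p) :
    twistD A ξ a p p' x = ((A.X a).d p p' x.1 + ξ.app a h x.2, 0) := by
  simp [twistD, h]

/-- As `d_V = 0`, attaching elements are cycles; this is what makes the twisted differential square
to zero. -/
theorem IsAttaching.d_apply {N : WithTop ℤ} {d : ℤ} {A : ModularOperad k N}
    {V : ModularModule k N} {ξ : GradedMap V A.toModularModule 1} (hξ : IsAttaching ξ)
    (hV : IsPureOfDim V d) (a : StablePair N) {i j l : ℤ}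
    (h : j + 1 = i) (h' : l + 1 = j) (v : (V.X a).X i) : (A.X a).d j l (ξ.app a h v) = 0 := by
  rw [hξ a h h', hV.d_apply, map_zero, neg_zero]

/-- The complexes of the operad obtained by adjoining `V`. -/
@[simps]
def twistX (a : StablePair (n : WithTop ℤ)) : ChainComplex (ModuleCat.{u} k) ℤ where
  X p := ModuleCat.of k ((A.X a).X p × (V.X a).X p)
  d p p' := ModuleCat.ofHom (twistD A ξ a p p')
  shape p p' h := ModuleCat.hom_ext <| LinearMap.ext fun x => by
    have h : ¬ p' + 1 = p := h
    change twistD A ξ a p p' x = 0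
    simp [twistD, h]
  d_comp_d' p p' p'' h h' := ModuleCat.hom_ext <| LinearMap.ext fun x => by
    change twistD A ξ a p' p'' (twistD A ξ a p p' x) = 0
    rw [twistD_apply ξ a h, twistD_apply ξ a h']
    simp only [map_add, map_zero, add_zero, d_d_apply, hξ.d_apply hV a h h', Prod.mk_zero_zero]

/-- The operad obtained from `A` by adjoining generators `V` in the top modular dimension. -/
def twist : ModularOperad k (n : WithTop ℤ) where
  X := twistX A hV hξ
  act a σ :=
    { f := fun p => ModuleCat.ofHom (((A.act a σ).f p).hom.prodMap ((V.act a σ).f p).hom)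
      comm' := fun p p' (h : p' + 1 = p) => ModuleCat.hom_ext <|
        LinearMap.ext fun (x : (A.X a).X p × (V.X a).X p) => by
        change twistD A ξ a p p' ((A.act a σ).f p x.1, (V.act a σ).f p x.2) =
          (((A.act a σ).f p').hom.prodMap ((V.act a σ).f p').hom) (twistD A ξ a p p' x)
        rw [twistD_apply ξ a h, twistD_apply ξ a h]
        dsimp only
        rw [ξ.act, act_d_apply]
        exact Prod.ext (map_add _ _ _).symm (map_zero ((V.act a σ).f p').hom).symm }
  -- The component in `V` is discarded on input and zero on output. This is a chain map because `V`
  -- vanishes at `a`, whose dimension is below `n`.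
  contr {a c} hg e :=
    { f := fun p => ModuleCat.ofHom
        (LinearMap.inl k _ _ ∘ₗ ((A.contr hg e).f p).hom ∘ₗ LinearMap.fst k _ _)
      comm' := fun p p' (h : p' + 1 = p) => ModuleCat.hom_ext <|
        LinearMap.ext fun (x : (A.X a).X p × (V.X a).X p) => by
        change twistD A ξ c p p' ((A.contr hg e).f p x.1, 0) =
          ((A.contr hg e).f p' (twistD A ξ a p p' x).1, 0)
        rw [twistD_apply ξ c h, twistD_apply ξ a h, contr_d_apply,
          hV.eq_zero (ne_of_contr hg e) x.2, map_zero, map_zero, add_zero, add_zero] }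
  comp {a b c} hg e he p q r h :=
    ((A.comp hg e he h).compl₁₂ (LinearMap.fst k _ ((V.X a).X p))
      (LinearMap.fst k _ ((V.X b).X q))).compr₂ (LinearMap.inl k _ ((V.X c).X r))
  act_one a := HomologicalComplex.hom_ext _ _ fun p => ModuleCat.hom_ext <|
    LinearMap.ext fun x => Prod.ext
      (ConcreteCategory.congr_hom (HomologicalComplex.congr_hom (A.act_one a) p) x.1)
      (ConcreteCategory.congr_hom (HomologicalComplex.congr_hom (V.act_one a) p) x.2)
  act_mul a σ τ := HomologicalComplex.hom_ext _ _ fun p => ModuleCat.hom_ext <|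
    LinearMap.ext fun x => Prod.ext
      (ConcreteCategory.congr_hom (HomologicalComplex.congr_hom (A.act_mul a σ τ) p) x.1)
      (ConcreteCategory.congr_hom (HomologicalComplex.congr_hom (V.act_mul a σ τ) p) x.2)
  comp_d {a b c} hg e he p q r p' q' r' h h₁ h₂ h₃
      (x : (A.X a).X p × (V.X a).X p) (y : (A.X b).X q × (V.X b).X q) := by
    have hx : p' + 1 = p := by omega
    have hy : q' + 1 = q := by omega
    change twistD A ξ c r r' (A.comp hg e he h x.1 y.1, 0) =
      ((A.comp hg e he h₁ (twistD A ξ a p p' x).1 y.1, 0) : (A.X c).X r' × (V.X c).X r') +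
        koszul k p • ((A.comp hg e he h₂ x.1 (twistD A ξ b q q' y).1, 0) :
          (A.X c).X r' × (V.X c).X r')
    rw [twistD_apply ξ c h₃, twistD_apply ξ a hx, twistD_apply ξ b hy,
      A.comp_d hg e he h h₁ h₂ h₃, hV.eq_zero (ne_of_comp_left hg e) x.2,
      hV.eq_zero (ne_of_comp_right hg e) y.2]
    simp
  comp_act_in hg e he σ τ he' p q r h x y :=
    Prod.ext (A.comp_act_in hg e he σ τ he' h x.1 y.1) rfl
  comp_act_out {a b c} hg e he σ he' p q r h x y :=
    Prod.ext (A.comp_act_out hg e he σ he' h x.1 y.1) (map_zero ((V.act c σ).f r).hom)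
  contr_act_in hg e σ := HomologicalComplex.hom_ext _ _ fun p => ModuleCat.hom_ext <|
    LinearMap.ext fun x => Prod.ext (ConcreteCategory.congr_hom
      (HomologicalComplex.congr_hom (A.contr_act_in hg e σ) p) x.1) rfl
  contr_act_out {a c} hg e σ := HomologicalComplex.hom_ext _ _ fun p => ModuleCat.hom_ext <|
    LinearMap.ext fun x => Prod.ext (ConcreteCategory.congr_hom
      (HomologicalComplex.congr_hom (A.contr_act_out hg e σ) p) x.1)
      (map_zero ((V.act c σ).f p).hom)
  comp_comm hg hg' e he he' p q r h h' x y :=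
    Prod.ext (A.comp_comm hg hg' e he he' h h' x.1 y.1) (smul_zero _).symm
  contr_comm hg e := HomologicalComplex.hom_ext _ _ fun p => ModuleCat.hom_ext <|
    LinearMap.ext fun x => Prod.ext (ConcreteCategory.congr_hom
      (HomologicalComplex.congr_hom (A.contr_comm hg e) p) x.1) rfl
  comp_assoc hab ht hbc ht' e f e' f' he hf he' hf' h h' h'' _ _ _ _ _ _ h₁ h₂ h₃ h₄ x y z :=
    Prod.ext (A.comp_assoc hab ht hbc ht' e f e' f' he hf he' hf' h h' h'' h₁ h₂ h₃ h₄
      x.1 y.1 z.1) rfl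
  contr_contr h₁ h₂ h₃ h₄ e f e' f' h := HomologicalComplex.hom_ext _ _ fun p =>
    ModuleCat.hom_ext <| LinearMap.ext fun x => Prod.ext (ConcreteCategory.congr_hom
      (HomologicalComplex.congr_hom (A.contr_contr h₁ h₂ h₃ h₄ e f e' f' h) p) x.1) rfl
  contr_comp_left h₁ h₂ h₃ h₄ e f e' f' he hf' h h' p q r h'' x y :=
    Prod.ext (A.contr_comp_left h₁ h₂ h₃ h₄ e f e' f' he hf' h h' h'' x.1 y.1) rfl
  contr_comp h₁ h₂ h₃ h₄ e f e' f' he he' h p q r h' x y :=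
    Prod.ext (A.contr_comp h₁ h₂ h₃ h₄ e f e' f' he he' h h' x.1 y.1) rfl

/-- The inclusion of `A`. -/
def twistInl : A ⟶ twist A hV hξ where
  app a :=
    { f := fun p => ModuleCat.ofHom (LinearMap.inl k _ _)
      comm' := fun p p' (h : p' + 1 = p) => ModuleCat.hom_ext <| LinearMap.ext fun x => by
        change twistD A ξ a p p' (x, 0) = ((A.X a).d p p' x, 0)
        rw [twistD_apply ξ a h, map_zero, add_zero] }
  act a σ := HomologicalComplex.hom_ext _ _ fun p => ModuleCat.hom_ext <|
    LinearMap.ext fun x => Prod.ext rfl (map_zero ((V.act a σ).f p).hom).symm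
  contr _ _ := rfl
  comp _ _ _ _ _ _ _ _ _ := rfl

/-- The inclusion of `V`. -/
def twistInr : GradedMap V (twist A hV hξ).toModularModule 0 :=
  .ofDegreeZero (fun a i => LinearMap.inr k ((A.X a).X i) ((V.X a).X i))
    (fun a σ i _ => Prod.ext (map_zero ((A.act a σ).f i).hom).symm rfl)

variable {A} in
/-- The morphism out of `A ⊔_ξ V` given by `f` and `g`. -/
def twistDesc {Q : ModularOperad k (n : WithTop ℤ)} {f : A ⟶ Q}
    {g : GradedMap V Q.toModularModule 0} (hfg : IsCompatible ξ f g) : twist A hV hξ ⟶ Q where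
  app a :=
    { f := fun p => ModuleCat.ofHom (((f.app a).f p).hom.coprod (g.app a (add_zero p)))
      comm' := fun p p' (h : p' + 1 = p) => ModuleCat.hom_ext <|
        LinearMap.ext fun (x : (A.X a).X p × (V.X a).X p) => by
        change (Q.X a).d p p' ((f.app a).f p x.1 + g.app a (add_zero p) x.2) =
          (((f.app a).f p').hom.coprod (g.app a (add_zero p'))) (twistD A ξ a p p' x)
        rw [twistD_apply ξ a h, LinearMap.coprod_apply, map_zero, add_zero, map_add, map_add,
          Hom.d_apply]
        have := hfg a h x.2
        rw [hV.d_apply, map_zero, sub_zero] at this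
        rw [this] }
  act a σ := HomologicalComplex.hom_ext _ _ fun p => ModuleCat.hom_ext <|
    LinearMap.ext fun (x : (A.X a).X p × (V.X a).X p) => by
      change (f.app a).f p ((A.act a σ).f p x.1) + g.app a (add_zero p) ((V.act a σ).f p x.2) =
        (Q.act a σ).f p ((f.app a).f p x.1 + g.app a (add_zero p) x.2)
      rw [map_add, g.act, Hom.act_apply]
  contr {a c} hg e := HomologicalComplex.hom_ext _ _ fun p => ModuleCat.hom_ext <|
    LinearMap.ext fun (x : (A.X a).X p × (V.X a).X p) => by
      change (f.app c).f p ((A.contr hg e).f p x.1) + g.app c (add_zero p) 0 =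
        (Q.contr hg e).f p ((f.app a).f p x.1 + g.app a (add_zero p) x.2)
      rw [hV.eq_zero (ne_of_contr hg e) x.2, map_zero, map_zero, add_zero, add_zero,
        Hom.contr_apply]
  comp {a b c} hg e he p q r h
      (x : (A.X a).X p × (V.X a).X p) (y : (A.X b).X q × (V.X b).X q) := by
    change (f.app c).f r (A.comp hg e he h x.1 y.1) + g.app c (add_zero r) 0 =
      Q.comp hg e he h ((f.app a).f p x.1 + g.app a (add_zero p) x.2)
        ((f.app b).f q y.1 + g.app b (add_zero q) y.2)
    rw [hV.eq_zero (ne_of_comp_left hg e) x.2, hV.eq_zero (ne_of_comp_right hg e) y.2,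
      map_zero, map_zero, map_zero, add_zero, add_zero, add_zero, Hom.comp]

/-- A morphism out of `A ⊕ V` is the sum of its restrictions to the two summands. Conversely `f` and
`g` give a chain map by `d g = f ξ`, and the compositions and contractions impose nothing on `g`
since `V` never enters them. -/
theorem twist_isExtensionBy :
    IsExtensionBy ξ (twistInl A hV hξ) (twistInr A hV hξ) := by
  refine ⟨fun a i j h x => ?_, fun Q f g hfg => ⟨twistDesc hV hξ hfg, ⟨?_, ?_⟩, ?_⟩⟩
  · rw [hV.d_apply, map_zero, sub_zero]
    change twistD A ξ a i j (0, x) = (ξ.app a h x, 0)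
    rw [twistD_apply ξ a h, map_zero, zero_add]
  · ext a p x
    change (f.app a).f p x + g.app a (add_zero p) 0 = _
    rw [map_zero, add_zero]
  · intro a i x
    change (f.app a).f i 0 + g.app a (add_zero i) x = _
    rw [map_zero, zero_add]
  · rintro φ ⟨rfl, hg⟩
    refine hom_ext fun a => HomologicalComplex.hom_ext _ _ fun p => ModuleCat.hom_ext <|
      LinearMap.ext fun x => ?_
    change (φ.app a).f p x = (φ.app a).f p (x.1, 0) + g.app a (add_zero p) x.2
    rw [← hg]
    refine Eq.trans ?_ (map_add ((φ.app a).f p).hom _ _)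
    exact congrArg ((φ.app a).f p) (Prod.ext (add_zero _).symm (zero_add _).symm)

end Twist

end ModularOperad

/-! ### Linear algebra -/

/-- Maschke's theorem, in the form of complements in the lattice of subrepresentations; `C` may be
infinite dimensional. -/
theorem exists_invariant_isCompl {k G C : Type*} [Field k] [CharZero k] [Group G] [Finite G]
    [AddCommGroup C] [Module k C] (act : G → C →ₗ[k] C) (act_one : act 1 = LinearMap.id)
    (act_mul : ∀ σ τ, act (σ * τ) = act τ ∘ₗ act σ) (B : Submodule k C)
    (hB : ∀ σ, ∀ x ∈ B, act σ x ∈ B) :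
    ∃ W : Submodule k C, (∀ σ, ∀ x ∈ W, act σ x ∈ W) ∧ IsCompl B W := by
  -- The given action is a right action, so inverses are taken to obtain a representation.
  let ρ : Representation k G C :=
    { toFun := fun σ => act σ⁻¹
      map_one' := by rw [inv_one, act_one]; rfl
      map_mul' := fun σ τ => by rw [mul_inv_rev, act_mul]; rfl }
  have : NeZero (Nat.card G : k) := ⟨Nat.cast_ne_zero.2 Nat.card_pos.ne'⟩
  let B' : Subrepresentation ρ := ⟨B, fun σ x hx => hB _ _ hx⟩
  obtain ⟨W, hW⟩ := exists_isCompl B'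
  refine ⟨W.toSubmodule, fun σ x hx => ?_, disjoint_iff.2 ?_, codisjoint_iff.2 ?_⟩
  · have := W.apply_mem_toSubmodule σ⁻¹ hx
    change act σ⁻¹⁻¹ x ∈ _ at this
    rwa [inv_inv] at this
  · exact congrArg Subrepresentation.toSubmodule (disjoint_iff.1 hW.1)
  · exact congrArg Subrepresentation.toSubmodule (codisjoint_iff.1 hW.2)

/-- Bijectivity on homology, written with cycles and boundaries: cycles of `K` that become
boundaries are boundaries, and every cycle of `L` is homologous to an image. -/
theorem ChainComplex.quasiIso_of_elements {k : Type u} [Ring k]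
    {K L : ChainComplex (ModuleCat.{u} k) ℤ} (f : K ⟶ L)
    (inj : ∀ i j (_ : j + 1 = i) (x : K.X i) (w : L.X (i + 1)), K.d i j x = 0 →
      f.f i x = L.d (i + 1) i w → ∃ y, x = K.d (i + 1) i y)
    (surj : ∀ i j (_ : j + 1 = i) (y : L.X i), L.d i j y = 0 →
      ∃ (x : K.X i) (w : L.X (i + 1)), K.d i j x = 0 ∧ y = f.f i x + L.d (i + 1) i w) :
    QuasiIso f := by
  rw [quasiIso_iff]
  intro i
  rw [quasiIsoAt_iff' f (i + 1) i (i - 1) (ChainComplex.prev ℤ i) (by simp)]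
  let φ := (HomologicalComplex.shortComplexFunctor' (ModuleCat.{u} k) _ (i + 1) i (i - 1)).map f
  let γ : ShortComplex.LeftHomologyMapData φ (ShortComplex.moduleCatLeftHomologyData _)
    (ShortComplex.moduleCatLeftHomologyData _) := default
  rw [γ.quasiIso_iff]
  have hφK (z) : (γ.φK z).1 = f.f i z.1 := ConcreteCategory.congr_hom γ.commi z
  have hφH (z) : γ.φH (Submodule.Quotient.mk z) = Submodule.Quotient.mk (γ.φK z) :=
    ConcreteCategory.congr_hom γ.commπ z
  refine (ConcreteCategory.isIso_iff_bijective _).2 ⟨?_, ?_⟩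
  · refine (injective_iff_map_eq_zero γ.φH.hom).2 fun y hy => ?_
    obtain ⟨z, rfl⟩ := Submodule.Quotient.mk_surjective _ y
    have hz := (hφH z).symm.trans hy
    obtain ⟨w, hw⟩ := (Submodule.Quotient.mk_eq_zero _).1 hz
    obtain ⟨y, hy⟩ := inj i (i - 1) (by simp) z.1 w z.2
      ((hφK z).symm.trans (congrArg Subtype.val hw).symm)
    exact (Submodule.Quotient.mk_eq_zero _).2 ⟨y, Subtype.ext hy.symm⟩
  · intro y
    obtain ⟨z, rfl⟩ := Submodule.Quotient.mk_surjective _ y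
    obtain ⟨x, w, hx, hw⟩ := surj i (i - 1) (by simp) z.1 z.2
    refine ⟨Submodule.Quotient.mk ⟨x, hx⟩, (hφH _).trans
      ((Submodule.Quotient.eq (LinearMap.range (ShortComplex.moduleCatToCycles _))).2
        (LinearMap.mem_range.2 ⟨w, Subtype.ext ?_⟩)).symm⟩
    exact eq_sub_of_add_eq' ((congrArg (· + _) (hφK ⟨x, hx⟩)).trans hw.symm)

namespace ModularOperad

variable {k : Type u} [Field k] {n : WithTop ℤ}

/-! ### Generators which kill the cone of a morphism -/

section Cone

variable {S P : ModularOperad k n} (ρ : S ⟶ P)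

/-- The components of the cone of `ρ`. -/
abbrev Cone (_ : S ⟶ P) (a : StablePair n) (i : ℤ) : Type u :=
  -- The product over the single `j` with `j + 1 = i` stands for `S_{i-1}` and avoids transports
  -- between degrees.
  (∀ j : {j : ℤ // j + 1 = i}, (S.X a).X j) × (P.X a).X i

/-- The action of the permutations of the legs on the cone. -/
def coneAct (a : StablePair n) (i : ℤ) (σ : Equiv.Perm a.Leg) : Cone ρ a i →ₗ[k] Cone ρ a i :=
  LinearMap.prodMap (LinearMap.pi fun j => ((S.act a σ).f j).hom ∘ₗ LinearMap.proj j)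
    ((P.act a σ).f i).hom

/-- The boundaries of the cone. -/
def coneBoundary (a : StablePair n) (i : ℤ) :
    ((S.X a).X i × (P.X a).X (i + 1)) →ₗ[k] Cone ρ a i :=
  -- The map `(x, q) ↦ (d x, ρ x + d q)`. For the cone differential `(s, p) ↦ (d s, ρ s - d p)` the
  -- sign of `q` would be opposite, which does not affect the range.
  LinearMap.prod (LinearMap.pi fun j => ((S.X a).d i j).hom ∘ₗ LinearMap.fst k _ _)
    (((ρ.app a).f i).hom.coprod ((P.X a).d (i + 1) i).hom)

/-- The cycles of the cone. -/
def coneCycles (a : StablePair n) (i : ℤ) : Submodule k (Cone ρ a i) where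
  carrier := {c | (∀ (j : {j : ℤ // j + 1 = i}) (l : ℤ), (S.X a).d j l (c.1 j) = 0) ∧
    ∀ j : {j : ℤ // j + 1 = i}, (P.X a).d i j c.2 = (ρ.app a).f j (c.1 j)}
  add_mem' hc hc' := ⟨fun j l => by
      rw [Prod.fst_add, Pi.add_apply, map_add, hc.1, hc'.1, add_zero],
    fun j => by rw [Prod.fst_add, Prod.snd_add, Pi.add_apply, map_add, map_add, hc.2, hc'.2]⟩
  zero_mem' := ⟨fun j l => map_zero _, fun j => (map_zero _).trans (map_zero _).symm⟩
  smul_mem' s c hc := ⟨fun j l => by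
      rw [Prod.smul_fst, Pi.smul_apply, map_smul, hc.1, smul_zero],
    fun j => by rw [Prod.smul_fst, Prod.smul_snd, Pi.smul_apply, map_smul, map_smul, hc.2]⟩

variable {ρ} in
theorem mem_coneCycles {a : StablePair n} {i : ℤ} {c : Cone ρ a i} :
    c ∈ coneCycles ρ a i ↔
      (∀ (j : {j : ℤ // j + 1 = i}) (l : ℤ), (S.X a).d j l (c.1 j) = 0) ∧
        ∀ j : {j : ℤ // j + 1 = i}, (P.X a).d i j c.2 = (ρ.app a).f j (c.1 j) :=
  Iff.rfl

theorem coneBoundary_mem (a : StablePair n) (i : ℤ) (x) :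
    coneBoundary ρ a i x ∈ coneCycles ρ a i := by
  refine mem_coneCycles.2 ⟨fun j l => S.d_d_apply a i j l x.1, fun j => ?_⟩
  change (P.X a).d i j ((ρ.app a).f i x.1 + (P.X a).d (i + 1) i x.2) =
    (ρ.app a).f j ((S.X a).d i j x.1)
  rw [map_add, P.d_d_apply, add_zero, Hom.d_apply]

theorem coneAct_boundary (a : StablePair n) (i : ℤ) (σ : Equiv.Perm a.Leg) (x) :
    coneAct ρ a i σ (coneBoundary ρ a i x) =
      coneBoundary ρ a i ((S.act a σ).f i x.1, (P.act a σ).f (i + 1) x.2) := by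
  refine Prod.ext (funext fun j => (S.act_d_apply σ j x.1).symm) ?_
  change (P.act a σ).f i ((ρ.app a).f i x.1 + (P.X a).d (i + 1) i x.2) =
    (ρ.app a).f i ((S.act a σ).f i x.1) + (P.X a).d (i + 1) i ((P.act a σ).f (i + 1) x.2)
  rw [map_add, act_d_apply, Hom.act_apply]

theorem coneAct_mem_cycles (a : StablePair n) (i : ℤ) (σ : Equiv.Perm a.Leg) (c)
    (hc : c ∈ coneCycles ρ a i) : coneAct ρ a i σ c ∈ coneCycles ρ a i := by
  rw [mem_coneCycles] at hc
  refine mem_coneCycles.2 ⟨fun j l => ?_, fun j => ?_⟩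
  · change (S.X a).d j l ((S.act a σ).f j (c.1 j)) = 0
    rw [act_d_apply, hc.1, map_zero]
  · change (P.X a).d i j ((P.act a σ).f i c.2) = (ρ.app a).f j ((S.act a σ).f j (c.1 j))
    rw [act_d_apply, hc.2, Hom.act_apply]

theorem coneAct_one (a : StablePair n) (i : ℤ) : coneAct ρ a i 1 = LinearMap.id :=
  LinearMap.ext fun _ => Prod.ext
    (funext fun j => ConcreteCategory.congr_hom (HomologicalComplex.congr_hom (S.act_one a) j) _)
    (ConcreteCategory.congr_hom (HomologicalComplex.congr_hom (P.act_one a) i) _)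

theorem coneAct_mul (a : StablePair n) (i : ℤ) (σ τ : Equiv.Perm a.Leg) :
    coneAct ρ a i (σ * τ) = coneAct ρ a i τ ∘ₗ coneAct ρ a i σ :=
  LinearMap.ext fun _ => Prod.ext
    (funext fun j =>
      ConcreteCategory.congr_hom (HomologicalComplex.congr_hom (S.act_mul a σ τ) j) _)
    (ConcreteCategory.congr_hom (HomologicalComplex.congr_hom (P.act_mul a σ τ) i) _)

/-- An invariant complement of the boundaries in the whole cone is cut down to the cycles. As
boundaries are cycles, the intersection is a complement of the boundaries within the cycles, hence
an equivariant copy of the homology of the cone. -/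
theorem exists_complement_of_boundaries [CharZero k] (a : StablePair n) (i : ℤ) :
    ∃ W : Submodule k (Cone ρ a i), (∀ σ, ∀ c ∈ W, coneAct ρ a i σ c ∈ W) ∧
      W ≤ coneCycles ρ a i ∧ (∀ x, coneBoundary ρ a i x ∈ W → coneBoundary ρ a i x = 0) ∧
      ∀ c ∈ coneCycles ρ a i, ∃ x, ∃ w ∈ W, c = coneBoundary ρ a i x + w := by
  obtain ⟨W, hW, hBW⟩ := exists_invariant_isCompl (coneAct ρ a i) (coneAct_one ρ a i)
    (coneAct_mul ρ a i) (LinearMap.range (coneBoundary ρ a i)) (by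
      rintro σ _ ⟨x, rfl⟩
      exact ⟨_, (coneAct_boundary ρ a i σ x).symm⟩)
  refine ⟨W ⊓ coneCycles ρ a i, fun σ c hc => ⟨hW σ c hc.1, coneAct_mem_cycles ρ a i σ c hc.2⟩,
    inf_le_right, fun x hx => ?_, fun c hc => ?_⟩
  · exact Submodule.disjoint_def.1 hBW.1 _ ⟨x, rfl⟩ hx.1
  · obtain ⟨_, ⟨x, rfl⟩, w, hw, rfl⟩ := Submodule.mem_sup.1
      (hBW.2.eq_top ▸ Submodule.mem_top : c ∈ LinearMap.range (coneBoundary ρ a i) ⊔ W)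
    exact ⟨x, w, ⟨hw, ((coneCycles ρ a i).add_mem_iff_right (coneBoundary_mem ρ a i x)).1 hc⟩, rfl⟩

/-- A family of invariant subspaces of the cone as a modular `Σ`-module. -/
def coneModule (U : ∀ a i, Submodule k (Cone ρ a i))
    (hU : ∀ a i σ, ∀ c ∈ U a i, coneAct ρ a i σ c ∈ U a i) : ModularModule k n where
  X a :=
    { X := fun i => ModuleCat.of k (U a i)
      d := fun _ _ => 0 }
  act a σ :=
    { f := fun i => ModuleCat.ofHom ((coneAct ρ a i σ).restrict (hU a i σ))
      comm' := fun i j _ => by rw [Limits.comp_zero, Limits.zero_comp] }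
  act_one a := HomologicalComplex.hom_ext _ _ fun i => ModuleCat.hom_ext <| LinearMap.ext fun c =>
    Subtype.ext (LinearMap.congr_fun (coneAct_one ρ a i) c.1)
  act_mul a σ τ := HomologicalComplex.hom_ext _ _ fun i => ModuleCat.hom_ext <|
    LinearMap.ext fun c => Subtype.ext (LinearMap.congr_fun (coneAct_mul ρ a i σ τ) c.1)

/-- The attaching map of `coneModule`. -/
def coneAttaching (U : ∀ a i, Submodule k (Cone ρ a i)) (hU) :
    GradedMap (coneModule ρ U hU) S.toModularModule 1 where
  app a i j h := LinearMap.proj (R := k) (φ := fun j : {j : ℤ // j + 1 = i} => (S.X a).X j) ⟨j, h⟩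
    ∘ₗ LinearMap.fst k _ _ ∘ₗ (U a i).subtype
  act _ _ _ _ _ _ := rfl

/-- The map of `coneModule` to the target of `ρ`. -/
def coneTarget (U : ∀ a i, Submodule k (Cone ρ a i)) (hU) :
    GradedMap (coneModule ρ U hU) P.toModularModule 0 :=
  .ofDegreeZero (fun a i => LinearMap.snd k _ _ ∘ₗ (U a i).subtype) (fun _ _ _ _ => rfl)

/-- At `a`, the pairs `(ξ v, g v)` represent the homology classes of the cone of `ρ`. -/
def IsConeHomology {V : ModularModule k n} (ξ : GradedMap V S.toModularModule 1) (ρ : S ⟶ P)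
    (g : GradedMap V P.toModularModule 0) (a : StablePair n) : Prop :=
  ∀ {i j : ℤ} (h : j + 1 = i),
    (∀ (v : (V.X a).X i) (x : (S.X a).X i) (p : (P.X a).X (i + 1)),
      ξ.app a h v = (S.X a).d i j x →
      g.app a (add_zero i) v = (ρ.app a).f i x + (P.X a).d (i + 1) i p → v = 0) ∧
    ∀ (s : (S.X a).X j) (p : (P.X a).X i), (∀ l, (S.X a).d j l s = 0) →
      (P.X a).d i j p = (ρ.app a).f j s →
      ∃ (x : (S.X a).X i) (q : (P.X a).X (i + 1)) (v : (V.X a).X i),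
        s = (S.X a).d i j x + ξ.app a h v ∧
        p = (ρ.app a).f i x + (P.X a).d (i + 1) i q + g.app a (add_zero i) v

-- In dimension `d` the module is the chosen space of representatives, elsewhere zero; `ξ` and `g`
-- are the two projections. Being a cone cycle says exactly that `ξ` is attaching and that `d g = ρ
-- ξ`.
open Classical in
theorem exists_cone_generators [CharZero k] (d : ℤ) :
    ∃ (V : ModularModule k n) (ξ : GradedMap V S.toModularModule 1)
      (g : GradedMap V P.toModularModule 0), IsPureOfDim V d ∧ IsAttaching ξ ∧
      IsCompatible ξ ρ g ∧ ∀ a : StablePair n, a.dim = d → IsConeHomology ξ ρ g a := by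
  choose W hWact hWcyc hWdisj hWspan using exists_complement_of_boundaries ρ
  let U : ∀ a i, Submodule k (Cone ρ a i) := fun a i => if a.dim = d then W a i else ⊥
  have hUW (a i) : U a i ≤ W a i := by
    dsimp only [U]
    split_ifs
    exacts [le_rfl, bot_le]
  have hU (a i σ) (c) (hc : c ∈ U a i) : coneAct ρ a i σ c ∈ U a i := by
    dsimp only [U] at hc ⊢
    split_ifs at hc ⊢
    · exact hWact a i σ c hc
    · rw [(Submodule.mem_bot k).1 hc, map_zero]
      exact zero_mem _
  refine ⟨coneModule ρ U hU, coneAttaching ρ U hU, coneTarget ρ U hU,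
    ⟨fun a ha i => ?_, fun _ _ _ => rfl⟩, fun a i j l h h' v => ?_, fun a i j h v => ?_,
    fun a ha i j h => ⟨fun v x p hv hv' => ?_, fun s p hs hp => ?_⟩⟩
  · have : U a i = ⊥ := if_neg ha
    change Subsingleton (U a i)
    rw [this]
    infer_instance
  · change (S.X a).d j l (v.1.1 ⟨j, h⟩) = -(coneAttaching ρ U hU).app a h' 0
    rw [map_zero, neg_zero]
    exact (mem_coneCycles.1 (hWcyc _ _ (hUW _ _ v.2))).1 ⟨j, h⟩ l
  · change (P.X a).d i j v.1.2 - (coneTarget ρ U hU).app a (add_zero j) 0 =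
      (ρ.app a).f j (v.1.1 ⟨j, h⟩)
    rw [map_zero, sub_zero]
    exact (mem_coneCycles.1 (hWcyc _ _ (hUW _ _ v.2))).2 ⟨j, h⟩
  · have hvB : coneBoundary ρ a i (x, p) = v.1 := by
      refine Prod.ext (funext ?_) hv'.symm
      rintro ⟨j', hj'⟩
      obtain rfl : j' = j := by omega
      exact hv.symm
    refine Subtype.ext ?_
    rw [← hvB]
    exact hWdisj a i _ (hvB ▸ hUW _ _ v.2)
  -- The pair `(s, p)` as a cone cycle, to be decomposed into a boundary and a representative.
  · let c : Cone ρ a i := (fun j' => (show j = j' by have := j'.2; omega) ▸ s, p)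
    obtain ⟨⟨x, q⟩, w, hw, hc⟩ := hWspan a i c (by
      refine mem_coneCycles.2 ⟨?_, ?_⟩
      · rintro ⟨j', hj'⟩ l
        obtain rfl : j = j' := by omega
        exact hs l
      · rintro ⟨j', hj'⟩
        obtain rfl : j = j' := by omega
        exact hp)
    have hw' : w ∈ U a i := by
      rw [show U a i = W a i from if_pos ha]
      exact hw
    exact ⟨x, q, ⟨w, hw'⟩, congrFun (congrArg Prod.fst hc) ⟨j, h⟩, congrArg Prod.snd hc⟩

end Cone

end ModularOperad

/-! ### Principal extensions and the inductive step -/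

namespace ModularOperad

open StablePair

variable {k : Type u} [Field k]

theorem isIso_app {n : WithTop ℤ} {P Q : ModularOperad k n} (f : P ⟶ Q) [IsIso f]
    (a : StablePair n) : IsIso (f.app a) :=
  ⟨(inv f).app a, congrArg (fun φ : P ⟶ P => φ.app a) (IsIso.hom_inv_id f),
    congrArg (fun φ : Q ⟶ Q => φ.app a) (IsIso.inv_hom_id f)⟩

theorem twistInl_desc {n : ℤ} {A : ModularOperad k (n : WithTop ℤ)}
    {V : ModularModule k (n : WithTop ℤ)} (hV : IsPureOfDim V n)
    {ξ : GradedMap V A.toModularModule 1} (hξ : IsAttaching ξ)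
    {Q : ModularOperad k (n : WithTop ℤ)} {f : A ⟶ Q} {g : GradedMap V Q.toModularModule 0}
    (hfg : IsCompatible ξ f g) : twistInl A hV hξ ≫ twistDesc hV hξ hfg = f :=
  hom_ext fun a => HomologicalComplex.hom_ext _ _ fun p => ModuleCat.hom_ext <|
    LinearMap.ext fun x => by
      change (f.app a).f p x + g.app a (add_zero p) 0 = _
      rw [map_zero, add_zero]

/-- The new generators cancel the homology of the cone of `f`: those with `ξ v ≠ 0` bound cycles of
`A` that die in `Q`, and the classes `g v` supply what is missing in the image. The proof needs only
the two clauses of `IsConeHomology`, used in the degrees `i` and `i + 1`. -/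
theorem quasiIso_twistDesc {n : ℤ} {A : ModularOperad k (n : WithTop ℤ)}
    {V : ModularModule k (n : WithTop ℤ)} (hV : IsPureOfDim V n)
    {ξ : GradedMap V A.toModularModule 1} (hξ : IsAttaching ξ)
    {Q : ModularOperad k (n : WithTop ℤ)} {f : A ⟶ Q} {g : GradedMap V Q.toModularModule 0}
    (hfg : IsCompatible ξ f g) {a : StablePair (n : WithTop ℤ)} (hcone : IsConeHomology ξ f g a) :
    QuasiIso ((twistDesc hV hξ hfg).app a) := by
  refine ChainComplex.quasiIso_of_elements _ ?_ ?_
  · rintro i j h ⟨x, v⟩ w hx hw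
    replace hx : (A.X a).d i j x + ξ.app a h v = 0 := congrArg Prod.fst
      ((twistD_apply ξ a h (x, v)).symm.trans hx)
    replace hw : (f.app a).f i x + g.app a (add_zero i) v = (Q.X a).d (i + 1) i w := hw
    -- The two equations say that `(ξ v, g v)` is the cone boundary of `(-x, w)`, and no nonzero
    -- representative is a boundary.
    have hv : v = 0 := (hcone h).1 v (-x) w
      (by rw [map_neg]; exact eq_neg_of_add_eq_zero_right hx)
      (by rw [← hw, map_neg, neg_add_cancel_left])
    subst hv
    rw [map_zero, add_zero] at hx hw
    -- Now `(x, w)` is a cone cycle of degree `i + 1`; its first coordinate reads `x = d x' + ξ v'`,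
    -- the twisted differential of `(x', v')`.
    obtain ⟨x', q, v', hx', -⟩ := (hcone (rfl : i + 1 = i + 1)).2 x w (fun l => by
      by_cases hl : l + 1 = i
      · obtain rfl : l = j := by omega
        exact hx
      · rw [(A.X a).shape i l hl]
        rfl) hw.symm
    refine ⟨(x', v'), ?_⟩
    refine Eq.trans ?_ (twistD_apply ξ a rfl (x', v')).symm
    exact Prod.ext hx' rfl
  · intro i j h y hy
    -- A cycle `y` of `Q` is the cone cycle `(0, y)`; the first coordinate of its decomposition says
    -- that `(x, v)` is a cycle.
    obtain ⟨x, q, v, hx, hy'⟩ := (hcone h).2 0 y (fun l => map_zero _)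
      (hy.trans (map_zero _).symm)
    refine ⟨(x, v), q, ?_, ?_⟩
    · refine (twistD_apply ξ a h (x, v)).trans ?_
      exact Prod.ext hx.symm rfl
    · rw [hy', add_right_comm]
      rfl

/-- The extension of a truncated principal extension along the left adjoint of the truncation. -/
theorem IsExtensionBy.of_trunc {m n : WithTop ℤ} {hmn : m ≤ n} {S R : ModularOperad k n}
    (hS : IsExtendedFrom hmn S) (hR : IsExtendedFrom hmn R) {V : ModularModule k n}
    (hV : ∀ a : StablePair n, ¬ (a.dim : WithTop ℤ) ≤ m → ∀ i, Subsingleton ((V.X a).X i))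
    {ξ : GradedMap V S.toModularModule 1} {ι : S ⟶ R}
    {γ : GradedMap (V.trunc hmn) ((trunc k hmn).obj R).toModularModule 0}
    (h : IsExtensionBy (P := (trunc k hmn).obj S) (ξ.trunc hmn) ((trunc k hmn).map ι) γ) :
    IsExtensionBy ξ ι (GradedMap.extend (W := R.toModularModule) hmn γ) := by
  refine ⟨fun a i j hij x => ?_, fun Q f g hfg => ?_⟩
  · by_cases ha : (a.dim : WithTop ℤ) ≤ m
    · rw [GradedMap.extend_app hmn γ a ha, GradedMap.extend_app hmn γ a ha]
      exact h.1 (a.restrict ha) hij x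
    · have := hV a ha
      rw [Subsingleton.elim x 0]
      simp only [map_zero, sub_zero]
  -- The universal property is used for the truncations, and the morphism found there extends
  -- uniquely to `R`. Above dimension `m` there is no condition on `V`, which vanishes.
  · obtain ⟨φ₀, ⟨hφ₀, hφ₀'⟩, huniq⟩ := h.2 ((trunc k hmn).obj Q) ((trunc k hmn).map f)
      (GradedMap.trunc hmn g) (fun a _ _ hij x => hfg (a.incl hmn) hij x)
    obtain ⟨φ, hφ⟩ := (hR Q).2 φ₀
    replace hφ : (trunc k hmn).map φ = φ₀ := hφ
    refine ⟨φ, ⟨?_, fun a i x => ?_⟩, fun ψ hψ => ?_⟩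
    · apply (hS Q).1
      change (trunc k hmn).map _ = (trunc k hmn).map f
      rw [Functor.map_comp, hφ, hφ₀]
    · by_cases ha : (a.dim : WithTop ℤ) ≤ m
      · rw [GradedMap.extend_app hmn γ a ha]
        have := hφ₀' (a.restrict ha) i x
        rw [← hφ] at this
        exact this
      · have := hV a ha
        rw [Subsingleton.elim x 0]
        simp only [map_zero]
    · apply (hR Q).1
      change (trunc k hmn).map _ = (trunc k hmn).map _
      rw [hφ]
      refine huniq _ ⟨?_, fun a i x => ?_⟩
      · rw [← Functor.map_comp, hψ.1]
      · have := hψ.2 (a.incl hmn) i x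
        rw [GradedMap.extend_app hmn γ (a.incl hmn) a.le] at this
        exact this

theorem IsExtensionBy.comp_iso {n : WithTop ℤ} {P R R' : ModularOperad k n}
    {V : ModularModule k n} {ξ : GradedMap V P.toModularModule 1} {ι : P ⟶ R}
    {γ : GradedMap V R.toModularModule 0} (h : IsExtensionBy ξ ι γ) (η : R ⟶ R') [IsIso η] :
    IsExtensionBy ξ (ι ≫ η) (γ.postcomp η) := by
  refine ⟨fun a i j hij x => ?_, fun Q f g hfg => ?_⟩
  · have := congrArg ((η.app a).f j) (h.1 a hij x)
    rw [map_sub] at this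
    rw [GradedMap.postcomp_app, GradedMap.postcomp_app, Hom.d_apply, this]
    rfl
  · obtain ⟨φ, ⟨hφ, hφ'⟩, huniq⟩ := h.2 Q f g hfg
    refine ⟨inv η ≫ φ, ⟨by simpa using hφ, fun a i x => ?_⟩, fun ψ hψ => ?_⟩
    · rw [← hφ']
      exact ConcreteCategory.congr_hom (HomologicalComplex.congr_hom
        (congrArg (fun φ : R ⟶ Q => φ.app a) (IsIso.hom_inv_id_assoc η φ)) i) _
    · rw [IsIso.eq_inv_comp]
      refine huniq _ ⟨by rw [← hψ.1, Category.assoc], fun a i x => hψ.2 a i x⟩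

theorem IsExtensionBy.iso_comp {n : WithTop ℤ} {P P' R : ModularOperad k n}
    {V : ModularModule k n} {ξ : GradedMap V P.toModularModule 1} {ι : P ⟶ R}
    {γ : GradedMap V R.toModularModule 0} (h : IsExtensionBy ξ ι γ) (η : P ⟶ P') [IsIso η]
    {ι' : P' ⟶ R} (hι' : η ≫ ι' = ι) : IsExtensionBy (ξ.postcomp η) ι' γ := by
  subst hι'
  refine ⟨fun a i j hij x => h.1 a hij x, fun Q f g hfg => ?_⟩
  obtain ⟨φ, ⟨hφ, hφ'⟩, huniq⟩ := h.2 Q (η ≫ f) g (fun a _ _ hij x => hfg a hij x)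
  refine ⟨φ, ⟨?_, hφ'⟩, fun ψ hψ => huniq ψ ⟨by rw [Category.assoc, hψ.1], hψ.2⟩⟩
  rwa [Category.assoc, cancel_epi] at hφ

theorem IsAttaching.postcomp {n : WithTop ℤ} {P Q : ModularOperad k n} {V : ModularModule k n}
    {ξ : GradedMap V P.toModularModule 1} (hξ : IsAttaching ξ) (f : P ⟶ Q) :
    IsAttaching (ξ.postcomp f) := fun a i j l h h' x => by
  rw [GradedMap.postcomp_app, GradedMap.postcomp_app, Hom.d_apply, hξ a h h', map_neg]

theorem IsPrincipalExtension.of_iso {n : WithTop ℤ} {d : ℤ} {P P' R R' : ModularOperad k n}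
    {ι : P ⟶ R} (h : IsPrincipalExtension d ι) {ι' : P' ⟶ R'} (α : P ⟶ P') (β : R ⟶ R')
    [IsIso α] [IsIso β] (comm : ι ≫ β = α ≫ ι') : IsPrincipalExtension d ι' := by
  obtain ⟨V, ξ, γ, hV, hξ, hγ⟩ := h
  exact ⟨V, ξ.postcomp α, γ.postcomp β, hV, hξ.postcomp α, (hγ.comp_iso β).iso_comp α comm.symm⟩

/-- Attaching generators in dimension `n` to make `ρ` a quasi-isomorphism in that dimension. -/
theorem exists_principalExtension [CharZero k] (n : ℤ) {S P : ModularOperad k ⊤}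
    (hS : IsExtendedFrom (le_top : ((n - 1 : ℤ) : WithTop ℤ) ≤ ⊤) S) (ρ : S ⟶ P) :
    ∃ (S' : ModularOperad k ⊤) (ι : S ⟶ S') (ρ' : S' ⟶ P), ι ≫ ρ' = ρ ∧
      IsExtendedFrom (le_top : (n : WithTop ℤ) ≤ ⊤) S' ∧ IsPrincipalExtension n ι ∧
      (∀ a : StablePair ⊤, a.dim < n → ∀ p, Function.Bijective ((ι.app a).f p)) ∧
      ∀ a : StablePair ⊤, a.dim = n → QuasiIso (ρ'.app a) := by
  obtain ⟨V, ξ, g, hV, hξ, hg, hcone⟩ := exists_cone_generators ρ n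
  let hn : (n : WithTop ℤ) ≤ ⊤ := le_top
  replace hS : IsExtendedFrom hn S := hS.mono (WithTop.coe_le_coe.2 (sub_one_lt n).le) hn
  let A := (trunc k hn).obj S
  have hV' : IsPureOfDim (V.trunc hn) n := ⟨fun a ha => hV.1 (a.incl hn) ha, fun a => hV.2 _⟩
  have hξ' : IsAttaching (P := A) (ξ.trunc hn) := fun a => hξ (a.incl hn)
  have hg' : IsCompatible (P := A) (Q := (trunc k hn).obj P) (ξ.trunc hn) ((trunc k hn).map ρ)
    (g.trunc hn) := fun a => hg (a.incl hn)
  let B := twist A hV' hξ'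
  let R := (tShriek k hn).obj B
  let η : B ⟶ (trunc k hn).obj R := (tShriekAdj k hn).unit.app B
  let desc : B ⟶ (trunc k hn).obj P := twistDesc hV' hξ' hg'
  -- As `S` is generated in dimensions `≤ n`, the inclusion of `t_n S` into the twisted operad
  -- determines `ι`.
  obtain ⟨ι, hι⟩ := (hS R).2 (twistInl A hV' hξ' ≫ η)
  replace hι : (trunc k hn).map ι = _ := hι
  have hR : IsExtendedFrom hn R := isExtendedFrom_tShriek hn B
  let ρ' : R ⟶ P := ((tShriekAdj k hn).homEquiv _ _).symm desc
  have hρ' : η ≫ (trunc k hn).map ρ' = desc := by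
    have := ((tShriekAdj k hn).homEquiv _ _).apply_symm_apply desc
    rwa [Adjunction.homEquiv_unit] at this
  refine ⟨R, ι, ρ', ?_, hR, ⟨V, ξ, _, hV, hξ, IsExtensionBy.of_trunc hS hR ?_
    (hι ▸ (twist_isExtensionBy A hV' hξ').comp_iso η)⟩, fun a ha p => ?_, fun a ha => ?_⟩
  · apply (hS P).1
    change (trunc k hn).map _ = (trunc k hn).map _
    rw [Functor.map_comp, hι, Category.assoc, hρ']
    exact twistInl_desc hV' hξ' hg'
  · intro a ha
    exact hV.1 a fun h => ha (h ▸ le_rfl)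
  · let a' : StablePair (n : WithTop ℤ) := a.restrict (WithTop.coe_le_coe.2 ha.le)
    have h₁ : Function.Bijective (((twistInl A hV' hξ').app a').f p) :=
      ⟨fun x y h => congrArg Prod.fst h, fun x => ⟨x.1, Prod.ext rfl
        (hV'.eq_zero (a := a') ha.ne _).symm⟩⟩
    have h₂ := (bijective_of_isIso η a' p).comp h₁
    have := congrArg (fun φ : A ⟶ (trunc k hn).obj R => ⇑((φ.app a').f p)) hι
    exact (congrArg Function.Bijective this).mpr h₂
  · let a' : StablePair (n : WithTop ℤ) := a.restrict (WithTop.coe_le_coe.2 ha.le)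
    -- In dimensions `≤ n` the morphism `ρ'` is `desc` up to the isomorphism `η`.
    have hq : QuasiIso (desc.app a') :=
      quasiIso_twistDesc hV' hξ' hg' (hcone a ha)
    have := isIso_app η a'
    have h := congrArg (fun φ : B ⟶ (trunc k hn).obj P => φ.app a') hρ'
    change η.app a' ≫ ρ'.app a = desc.app a' at h
    exact (quasiIso_iff_comp_left (η.app a') (ρ'.app a)).1 (h ▸ hq)

end ModularOperad

namespace ModularOperad

open StablePair

variable {k : Type u} [Field k]

/-! ### Every operad is the direct limit of its canonical tower -/

/-- The component at `a` is read off from any `F n` with `a.dim ≤ n`. An operation with output `c`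
involves only dimensions `≤ c.dim`, so `F c.dim.toNat` already respects it. -/
theorem existsUnique_hom_of_trunc {M Q : ModularOperad k ⊤}
    (F : ∀ n : ℕ, (trunc k (le_top : ((n : ℤ) : WithTop ℤ) ≤ ⊤)).obj M ⟶ (trunc k le_top).obj Q)
    (hF : ∀ (m n : ℕ) (h : (m : ℤ) ≤ n), (trunc k (WithTop.coe_le_coe.2 h)).map (F n) = F m) :
    ∃! φ : M ⟶ Q, ∀ n : ℕ, (trunc k le_top).map φ = F n := by
  have le_toNat (a : StablePair ⊤) : (a.dim : WithTop ℤ) ≤ ((a.dim.toNat : ℤ) : WithTop ℤ) :=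
    WithTop.coe_le_coe.2 (Int.self_le_toNat _)
  have happ (a : StablePair ⊤) (n : ℕ) (h : (a.dim : WithTop ℤ) ≤ ((n : ℤ) : WithTop ℤ)) :
      (F a.dim.toNat).app (a.restrict (le_toNat a)) = (F n).app (a.restrict h) := by
    have h' : ((a.dim.toNat : ℕ) : ℤ) ≤ n := by
      rw [Int.toNat_of_nonneg a.dim_nonneg]
      exact WithTop.coe_le_coe.1 h
    rw [← hF _ _ h']
    rfl
  refine ⟨{
      app := fun a => (F a.dim.toNat).app (a.restrict (le_toNat a))
      act := fun a σ => (F a.dim.toNat).act (a.restrict (le_toNat a)) σ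
      contr := fun {a c} hg e => ?_
      comp := fun {a b c} hg e he p q r h x y => ?_ }, fun n => ?_, fun ψ hψ => ?_⟩
  · rw [happ a c.dim.toNat (le_of_contr hg e (le_toNat c))]
    exact (F c.dim.toNat).contr (a := a.restrict (le_of_contr hg e (le_toNat c)))
      (c := c.restrict (le_toNat c)) hg e
  · rw [happ a c.dim.toNat (le_of_comp_left hg e (le_toNat c)),
      happ b c.dim.toNat (le_of_comp_right hg e (le_toNat c))]
    exact (F c.dim.toNat).comp (a := a.restrict (le_of_comp_left hg e (le_toNat c)))
      (b := b.restrict (le_of_comp_right hg e (le_toNat c))) (c := c.restrict (le_toNat c))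
      hg e he h x y
  · exact hom_ext fun a => happ (a.incl le_top) n a.le
  · exact hom_ext fun a => congrArg (fun φ : (trunc k le_top).obj M ⟶ (trunc k le_top).obj Q =>
      φ.app (a.restrict (le_toNat a))) (hψ a.dim.toNat)

/-- Under the adjunctions, precomposition with a map of the canonical tower becomes further
truncation. -/
theorem homEquiv_stageMap_comp (M : ModularOperad k ⊤) {m n : ℤ} (h : m ≤ n)
    {Q : ModularOperad k ⊤} (f : M.stage n ⟶ Q) :
    (tShriekAdj k (le_top : (m : WithTop ℤ) ≤ ⊤)).homEquiv _ _ (M.stageMap h ≫ f) =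
      (trunc k (WithTop.coe_le_coe.2 h)).map
        ((tShriekAdj k (le_top : (n : WithTop ℤ) ≤ ⊤)).homEquiv _ _ f) := by
  rw [Adjunction.homEquiv_naturality_right]
  refine (congrArg (· ≫ (trunc k le_top).map f) (Equiv.apply_symm_apply _ _)).trans ?_
  rw [Adjunction.homEquiv_unit]
  exact ((trunc k (WithTop.coe_le_coe.2 h)).map_comp _ ((trunc k le_top).map f)).symm

theorem homEquiv_stageCounit_comp (M : ModularOperad k ⊤) (n : ℤ) {Q : ModularOperad k ⊤}
    (φ : M ⟶ Q) : (tShriekAdj k (le_top : (n : WithTop ℤ) ≤ ⊤)).homEquiv _ _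
      (M.stageCounit n ≫ φ) = (trunc k le_top).map φ := by
  rw [Adjunction.homEquiv_naturality_right, stageCounit, Adjunction.homEquiv_unit]
  exact ((tShriekAdj k (le_top : (n : WithTop ℤ) ≤ ⊤)).right_triangle_components_assoc M _)

/-- By adjunction a cocone on the canonical tower is a compatible family of morphisms `t_n M ⟶ t_n
Q`, and such families glue uniquely. -/
theorem isColimitOfTower (M : ModularOperad k ⊤) : M.IsColimitOfTower := by
  intro Q f hf
  have key (φ : M ⟶ Q) : (∀ n : ℕ, M.stageCounit n ≫ φ = f n) ↔ ∀ n : ℕ,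
      (trunc k le_top).map φ = (tShriekAdj k le_top).homEquiv _ _ (f n) :=
    forall_congr' fun n => by
      rw [← homEquiv_stageCounit_comp, EmbeddingLike.apply_eq_iff_eq]
  simp only [key]
  refine existsUnique_hom_of_trunc _ fun m n h => ?_
  rw [← homEquiv_stageMap_comp _ h, hf _ _ h]

/-! ### The limit of a tower which stabilizes in every modular dimension -/

section Limit

variable (T : ℕ ⥤ ModularOperad k ⊤)

/-- The stage of the tower at which the modular dimension of `a` is stable. -/
def level (a : StablePair ⊤) : ℕ := a.dim.toNat + 1

/-- The transition maps of the tower. -/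
def transition {i j : ℕ} (h : i ≤ j) (a : StablePair ⊤) : (T.obj i).X a ⟶ (T.obj j).X a :=
  (T.map (homOfLE h)).app a

theorem transition_comp {i j l : ℕ} (h : i ≤ j) (h' : j ≤ l) (a : StablePair ⊤) :
    transition T h a ≫ transition T h' a = transition T (h.trans h') a :=
  congrArg (fun φ : T.obj i ⟶ T.obj l => φ.app a)
    (T.map_comp (homOfLE h) (homOfLE h')).symm

theorem transition_refl {i : ℕ} (h : i ≤ i) (a : StablePair ⊤) : transition T h a = 𝟙 _ :=
  congrArg (fun φ : T.obj i ⟶ T.obj i => φ.app a) (T.map_id i)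

theorem transition_transition {i j l : ℕ} (h : i ≤ j) (h' : j ≤ l) (a : StablePair ⊤) {p : ℤ}
    (x : ((T.obj i).X a).X p) :
    (transition T h' a).f p ((transition T h a).f p x) = (transition T (h.trans h') a).f p x :=
  ConcreteCategory.congr_hom (HomologicalComplex.congr_hom (transition_comp T h h' a) p) x

theorem transition_act {i j : ℕ} (h : i ≤ j) (a : StablePair ⊤) (σ : Equiv.Perm a.Leg) :
    (T.obj i).act a σ ≫ transition T h a = transition T h a ≫ (T.obj j).act a σ :=
  (T.map (homOfLE h)).act a σ

theorem transition_act_apply {i j : ℕ} (h : i ≤ j) (a : StablePair ⊤) (σ : Equiv.Perm a.Leg)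
    {p : ℤ} (x : ((T.obj i).X a).X p) : (transition T h a).f p (((T.obj i).act a σ).f p x) =
      ((T.obj j).act a σ).f p ((transition T h a).f p x) :=
  Hom.act_apply (T.map (homOfLE h)) a σ p x

theorem transition_d {i j : ℕ} (h : i ≤ j) (a : StablePair ⊤) {p : ℤ} (q : ℤ)
    (x : ((T.obj i).X a).X p) : (transition T h a).f q (((T.obj i).X a).d p q x) =
      ((T.obj j).X a).d p q ((transition T h a).f p x) :=
  (Hom.d_apply (T.map (homOfLE h)) a p q x).symm

theorem transition_contr {i j : ℕ} (h : i ≤ j) {a c : StablePair ⊤} (hg : c.g = a.g + 1)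
    (e : a.Leg ≃ c.Leg ⊕ Bool) : (T.obj i).contr hg e ≫ transition T h c =
      transition T h a ≫ (T.obj j).contr hg e :=
  (T.map (homOfLE h)).contr hg e

theorem transition_contr_apply {i j : ℕ} (h : i ≤ j) {a c : StablePair ⊤} (hg : c.g = a.g + 1)
    (e : a.Leg ≃ c.Leg ⊕ Bool) {p : ℤ} (x : ((T.obj i).X a).X p) :
    (transition T h c).f p (((T.obj i).contr hg e).f p x) =
      ((T.obj j).contr hg e).f p ((transition T h a).f p x) :=
  Hom.contr_apply (T.map (homOfLE h)) hg e p x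

theorem transition_comp_apply {i j : ℕ} (h : i ≤ j) {a b c : StablePair ⊤}
    (hg : c.g = a.g + b.g) (e : a.Leg ⊕ b.Leg ≃ c.Leg ⊕ Bool) (he : Joins e) {p q r : ℤ}
    (hr : p + q = r) (x : ((T.obj i).X a).X p) (y : ((T.obj i).X b).X q) :
    (transition T h c).f r ((T.obj i).comp hg e he hr x y) =
      (T.obj j).comp hg e he hr ((transition T h a).f p x) ((transition T h b).f q y) :=
  (T.map (homOfLE h)).comp hg e he hr x y

theorem level_le_of_contr {a c : StablePair ⊤} (hg : c.g = a.g + 1) (e : a.Leg ≃ c.Leg ⊕ Bool) :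
    level a ≤ level c := by
  have := dim_of_contr hg e
  unfold level
  omega

theorem level_le_of_comp_left {a b c : StablePair ⊤} (hg : c.g = a.g + b.g)
    (e : a.Leg ⊕ b.Leg ≃ c.Leg ⊕ Bool) : level a ≤ level c := by
  have := dim_of_comp hg e
  have := b.dim_nonneg
  unfold level
  omega

theorem level_le_of_comp_right {a b c : StablePair ⊤} (hg : c.g = a.g + b.g)
    (e : a.Leg ⊕ b.Leg ≃ c.Leg ⊕ Bool) : level b ≤ level c := by
  have := dim_of_comp hg e
  have := a.dim_nonneg
  unfold level
  omega

/-- The limit of the tower. -/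
def towerLimit : ModularOperad k ⊤ where
  X a := (T.obj (level a)).X a
  act a σ := (T.obj (level a)).act a σ
  act_one a := (T.obj (level a)).act_one a
  act_mul a σ τ := (T.obj (level a)).act_mul a σ τ
  -- Inputs have smaller level than the output, so they are pushed forward to its stage and combined
  -- there. No transition map is inverted, and the axioms follow from those of that single stage.
  contr {a c} hg e := transition T (level_le_of_contr hg e) a ≫ (T.obj (level c)).contr hg e
  comp {a b c} hg e he p q r h := ((T.obj (level c)).comp hg e he h).compl₁₂
    ((transition T (level_le_of_comp_left hg e) a).f p).hom
    ((transition T (level_le_of_comp_right hg e) b).f q).hom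
  comp_d {a b c} hg e he p q r p' q' r' h h₁ h₂ h₃ x y := by
    simp only [LinearMap.compl₁₂_apply, transition_d]
    exact (T.obj (level c)).comp_d hg e he h h₁ h₂ h₃ _ _
  comp_act_in {a b c} hg e he σ τ he' p q r h x y := by
    simp only [LinearMap.compl₁₂_apply, transition_act_apply]
    exact (T.obj (level c)).comp_act_in hg e he σ τ he' h _ _
  comp_act_out {a b c} hg e he σ he' p q r h x y :=
    (T.obj (level c)).comp_act_out hg e he σ he' h _ _
  contr_act_in {a c} hg e σ := by
    rw [← Category.assoc, transition_act, Category.assoc, contr_act_in]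
  contr_act_out {a c} hg e σ := by rw [Category.assoc, contr_act_out]
  comp_comm {a b c} hg hg' e he he' p q r h h' x y :=
    (T.obj (level c)).comp_comm hg hg' e he he' h h' _ _
  contr_comm {a c} hg e := by rw [contr_comm]
  comp_assoc {a b c ab bc t} hab ht hbc ht' e f e' f' he hf he' hf' h h' h'' p q r pq qr s
      h₁ h₂ h₃ h₄ x y z := by
    simp only [LinearMap.compl₁₂_apply, transition_comp_apply, transition_transition]
    exact (T.obj (level t)).comp_assoc hab ht hbc ht' e f e' f' he hf he' hf' h h' h''
      h₁ h₂ h₃ h₄ _ _ _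
  contr_contr {a b b' c} h₁ h₂ h₃ h₄ e f e' f' h := by
    simp only [Category.assoc, reassoc_of% (transition_contr T), reassoc_of% (transition_comp T),
      contr_contr _ h₁ h₂ h₃ h₄ e f e' f' h]
  contr_comp_left {a b ab a' t} h₁ h₂ h₃ h₄ e f e' f' he hf' h h' p q r h'' x y := by
    simp only [LinearMap.compl₁₂_apply, HomologicalComplex.comp_f, ModuleCat.hom_comp,
      LinearMap.comp_apply, transition_comp_apply, transition_contr_apply, transition_transition]
    exact (T.obj (level t)).contr_comp_left h₁ h₂ h₃ h₄ e f e' f' he hf' h h' h'' _ _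
  contr_comp {a b ab ab' t} h₁ h₂ h₃ h₄ e f e' f' he he' h p q r h' x y := by
    simp only [LinearMap.compl₁₂_apply, HomologicalComplex.comp_f, ModuleCat.hom_comp,
      LinearMap.comp_apply, transition_comp_apply, transition_transition]
    exact (T.obj (level t)).contr_comp h₁ h₂ h₃ h₄ e f e' f' he he' h h' _ _

theorem towerLimit_contr_transition {i : ℕ} {a c : StablePair ⊤} (hg : c.g = a.g + 1)
    (e : a.Leg ≃ c.Leg ⊕ Bool) (ha : level a ≤ i) (hc : level c ≤ i) :
    (towerLimit T).contr hg e ≫ transition T hc c = transition T ha a ≫ (T.obj i).contr hg e := by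
  change (transition T (level_le_of_contr hg e) a ≫ (T.obj (level c)).contr hg e) ≫ _ = _
  rw [Category.assoc, transition_contr, ← Category.assoc, transition_comp]

theorem transition_towerLimit_comp {i : ℕ} {a b c : StablePair ⊤} (hg : c.g = a.g + b.g)
    (e : a.Leg ⊕ b.Leg ≃ c.Leg ⊕ Bool) (he : Joins e) {p q r : ℤ} (hr : p + q = r)
    (ha : level a ≤ i) (hb : level b ≤ i) (hc : level c ≤ i)
    (x : ((T.obj (level a)).X a).X p) (y : ((T.obj (level b)).X b).X q) :
    (transition T hc c).f r ((towerLimit T).comp hg e he hr x y) =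
      (T.obj i).comp hg e he hr ((transition T ha a).f p x) ((transition T hb b).f q y) := by
  change (transition T hc c).f r ((T.obj (level c)).comp hg e he hr
    ((transition T (level_le_of_comp_left hg e) a).f p x)
    ((transition T (level_le_of_comp_right hg e) b).f q y)) = _
  rw [transition_comp_apply, transition_transition, transition_transition]

/-- A compatible family of morphisms induces a morphism out of the limit. -/
def towerLimitDesc {P : ModularOperad k ⊤} (ρ : ∀ i, T.obj i ⟶ P)
    (hρ : ∀ i j (h : i ≤ j), T.map (homOfLE h) ≫ ρ j = ρ i) : towerLimit T ⟶ P where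
  app a := (ρ (level a)).app a
  act a σ := (ρ (level a)).act a σ
  contr {a c} hg e := by
    change (transition T (level_le_of_contr hg e) a ≫ (T.obj (level c)).contr hg e) ≫ _ = _
    rw [← hρ _ _ (level_le_of_contr hg e), Category.assoc, Hom.contr]
    rfl
  comp {a b c} hg e he p q r h x y := by
    rw [← hρ _ _ (level_le_of_comp_left hg e), ← hρ _ _ (level_le_of_comp_right hg e)]
    exact (ρ (level c)).comp hg e he h _ _

theorem level_le {n : ℤ} {i : ℕ} (h : n < i) (a : StablePair (n : WithTop ℤ)) :
    level (a.incl le_top) ≤ i := by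
  have h₁ : a.dim ≤ n := WithTop.coe_le_coe.1 a.dim_le
  have h₂ := a.dim_nonneg
  change a.dim.toNat + 1 ≤ i
  omega

/-- The truncation of the limit of the tower maps to the stages of the tower. -/
def truncTowerLimit {n : ℤ} {i : ℕ} (h : n < i) :
    (trunc k (le_top : (n : WithTop ℤ) ≤ ⊤)).obj (towerLimit T) ⟶
      (trunc k le_top).obj (T.obj i) where
  app a := transition T (level_le h a) (a.incl le_top)
  act a σ := transition_act T (level_le h a) (a.incl le_top) σ
  contr {a c} hg e := towerLimit_contr_transition T (a := a.incl le_top) (c := c.incl le_top) hg e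
    (level_le h a) (level_le h c)
  comp {a b c} hg e he _ _ _ hr x y := transition_towerLimit_comp T (a := a.incl le_top)
    (b := b.incl le_top) (c := c.incl le_top) hg e he hr (level_le h a) (level_le h b)
    (level_le h c) x y

variable {T}

theorem transition_bijective
    (hT : ∀ (i : ℕ) (a : StablePair ⊤), a.dim < i → ∀ p,
      Function.Bijective (((T.map (homOfLE i.le_succ)).app a).f p))
    {i j : ℕ} (h : i ≤ j) (a : StablePair ⊤) (ha : a.dim < i) (p : ℤ) :
    Function.Bijective ((transition T h a).f p) := by
  induction j, h using Nat.le_induction with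
  | base =>
    rw [transition_refl]
    exact Function.bijective_id
  | succ j h ih =>
    rw [← transition_comp T h j.le_succ]
    exact (hT j a (by omega) p).comp ih

/-- For `n < i` every pair of dimension `≤ n` has level at most `i`, and from its level on the tower
is constant at that pair. -/
theorem isIso_truncTowerLimit
    (hT : ∀ (i : ℕ) (a : StablePair ⊤), a.dim < i → ∀ p,
      Function.Bijective (((T.map (homOfLE i.le_succ)).app a).f p))
    {n : ℤ} {i : ℕ} (h : n < i) : IsIso (truncTowerLimit T h) :=
  isIso_of_bijective _ fun a p => transition_bijective hT (level_le h a) (a.incl le_top)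
    (Int.lt_add_one_of_le (Int.self_le_toNat _)) p

/-- The stage `t_! t_n` of the limit is `t_! t_n` of `T.obj (n + 1)`, which is `T.obj (n + 1)`
itself as that operad is generated in dimensions `≤ n`. The canonical tower is thus isomorphic to
`T`, whose steps are principal extensions. -/
theorem isMinimal_towerLimit
    (hT : ∀ (i : ℕ) (a : StablePair ⊤), a.dim < i → ∀ p,
      Function.Bijective (((T.map (homOfLE i.le_succ)).app a).f p))
    (hT' : ∀ i : ℕ, IsExtendedFrom (le_top : ((i - 1 : ℤ) : WithTop ℤ) ≤ ⊤) (T.obj i))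
    (hT'' : ∀ i : ℕ, IsPrincipalExtension i (T.map (homOfLE i.le_succ))) :
    (towerLimit T).IsMinimal := by
  have hT₁ (n : ℤ) (i : ℕ) (h : n < i) (h' : n = i - 1) :
      IsExtendedFrom (le_top : (n : WithTop ℤ) ≤ ⊤) (T.obj i) := h' ▸ hT' i
  let θ (n : ℤ) (i : ℕ) (h : n < i) : (towerLimit T).stage n ⟶ T.obj i :=
    ((tShriekAdj k le_top).homEquiv _ _).symm (truncTowerLimit T h)
  have hθ (n : ℤ) (i : ℕ) (h : n < i) (h' : n = i - 1) : IsIso (θ n i h) := by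
    have := isIso_truncTowerLimit hT h
    have := (hT₁ n i h h').isIso_counit
    dsimp only [θ]
    rw [Adjunction.homEquiv_counit]
    infer_instance
  intro n
  have h₁ : (n - 1 : ℤ) < n := sub_one_lt _
  have h₂ : (n : ℤ) < (n + 1 : ℕ) := by push_cast; exact lt_add_one _
  have := hθ _ _ h₁ rfl
  have := hθ _ _ h₂ (by push_cast; ring)
  refine (hT'' n).of_iso (inv (θ _ _ h₁)) (inv (θ _ _ h₂)) ?_
  rw [IsIso.comp_inv_eq, Category.assoc, IsIso.eq_inv_comp]
  -- After passing to adjoints, both sides of the square are transition maps of `T`.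
  apply ((tShriekAdj k le_top).homEquiv _ _).injective
  rw [homEquiv_stageMap_comp, Adjunction.homEquiv_naturality_right, Equiv.apply_symm_apply,
    Equiv.apply_symm_apply]
  exact hom_ext fun a => transition_comp T _ _ _

end Limit

/-! ### Existence of minimal models -/

/-- A stage of the tower of approximations of `P`. -/
structure Approximation (P : ModularOperad k ⊤) (i : ℕ) where
  S : ModularOperad k ⊤
  ρ : S ⟶ P
  isExtendedFrom : IsExtendedFrom (le_top : ((i - 1 : ℤ) : WithTop ℤ) ≤ ⊤) S

theorem exists_tower [CharZero k] (P : ModularOperad k ⊤) :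
    ∃ (T : ℕ ⥤ ModularOperad k ⊤) (ρ : ∀ i, T.obj i ⟶ P),
      (∀ i j (h : i ≤ j), T.map (homOfLE h) ≫ ρ j = ρ i) ∧
      (∀ i : ℕ, IsExtendedFrom (le_top : ((i - 1 : ℤ) : WithTop ℤ) ≤ ⊤) (T.obj i)) ∧
      (∀ i : ℕ, IsPrincipalExtension i (T.map (homOfLE i.le_succ))) ∧
      (∀ (i : ℕ) (a : StablePair ⊤), a.dim < i → ∀ p,
        Function.Bijective (((T.map (homOfLE i.le_succ)).app a).f p)) ∧
      ∀ (i : ℕ) (a : StablePair ⊤), a.dim = i → QuasiIso ((ρ (i + 1)).app a) := by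
  have step (i : ℕ) (A : Approximation P i) : ∃ (A' : Approximation P (i + 1)) (ι : A.S ⟶ A'.S),
      ι ≫ A'.ρ = A.ρ ∧ IsPrincipalExtension i ι ∧
      (∀ a : StablePair ⊤, a.dim < i → ∀ p, Function.Bijective ((ι.app a).f p)) ∧
      ∀ a : StablePair ⊤, a.dim = i → QuasiIso (A'.ρ.app a) := by
    obtain ⟨S', ι, ρ', h₁, h₂, h₃, h₄, h₅⟩ :=
      exists_principalExtension (i : ℤ) A.isExtendedFrom A.ρ
    have hi : ((i + 1 : ℕ) - 1 : ℤ) = i := by push_cast; ring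
    exact ⟨⟨S', ρ', by rw! [hi]; exact h₂⟩, ι, h₁, h₃, h₄, h₅⟩
  choose next ι hι using step
  -- The start is `t_! t_{-1} P ⟶ P`; as no stable pair has dimension `≤ -1`, its source is
  -- generated by nothing.
  let A₀ : Approximation P 0 := ⟨_, P.stageCounit _, isExtendedFrom_tShriek _ _⟩
  let A : ∀ i, Approximation P i := fun i => Nat.rec A₀ next i
  let T : ℕ ⥤ ModularOperad k ⊤ := Functor.ofSequence (X := fun i => (A i).S) fun i => ι i (A i)
  have hT (i : ℕ) : T.map (homOfLE i.le_succ) = ι i (A i) := Functor.ofSequence_map_homOfLE_succ _ i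
  refine ⟨T, fun i => (A i).ρ, fun i j h => ?_, fun i => (A i).isExtendedFrom, fun i => ?_,
    fun i a ha p => ?_, fun i => (hι i (A i)).2.2.2⟩
  · induction j, h using Nat.le_induction with
    | base => exact (congrArg (· ≫ _) (T.map_id i)).trans (Category.id_comp _)
    | succ j h ih =>
      rw [← homOfLE_comp h j.le_succ, T.map_comp, hT]
      exact (Category.assoc _ _ _).trans
        ((congrArg (T.map (homOfLE h) ≫ ·) (hι j (A j)).1).trans ih)
  · rw [hT]
    exact (hι i (A i)).2.1
  · rw [hT]
    exact (hι i (A i)).2.2.1 a ha p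

end ModularOperad

theorem mainTheorem5 (k : Type u) [Field k] [CharZero k] (P : ModularOperad.{u} k ⊤) :
    ∃ (M : ModularOperad.{u} k ⊤) (ρ : M ⟶ P),
      ModularOperad.IsMinimalModel ρ ∧ M.IsColimitOfTower := by
  obtain ⟨T, ρ, h₁, h₂, h₃, h₄, h₅⟩ := ModularOperad.exists_tower P
  exact ⟨ModularOperad.towerLimit T, ModularOperad.towerLimitDesc T ρ h₁,
    -- The component at `a` is by definition that of `ρ (a.dim.toNat + 1)`, the first stage which is
    -- a quasi-isomorphism there by construction.
    ⟨ModularOperad.isMinimal_towerLimit h₄ h₂ h₃, fun a =>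
      h₅ a.dim.toNat a (Int.toNat_of_nonneg a.dim_nonneg).symm⟩,
    ModularOperad.isColimitOfTower _⟩
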